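/- Let $\mathbb{R}^+=(0,\infty)$ and let $V\in L^\infty(\mathbb{R}^+)$ be real-valued with $V\ge\varepsilon>0$ almost everywhere. On $L^2(\mathbb{R}^+)$ (inner product linear in the second entry) consider the symmetric operator $S$ with domain $H^2_0(\mathbb{R}^+)=\{f\in H^2(\mathbb{R}^+): f(0)=f'(0)=0\}$ and $Sf=-f''+Vf$. A densely defined operator $B$ is called dissipative if $\operatorname{Im}\langle f,Bf\rangle\ge 0$ for all $f\in\mathcal{D}(B)$, and maximally dissipative if moreover it has no non-trivial dissipative extension; $B$ is called maximally accretive if $iB$ is maximally dissipative. The Friedrichs extension $S_F$ of $S$ has domain $\mathcal{D}(S_F)=\{\ell\in H^2(\mathbb{R}^+):\ell(0)=0\}$ and acts as $S_F\ell=-\ell''+V\ell$. There is exactly one function $\eta\in H^2(\mathbb{R}^+)$ with $\eta''=V\eta$ and $\eta(0)=1$, and $\eta'(0)$ is real. For $\ell\in\mathcal{D}(S_F)$ and $v\in L^2(\mathbb{R}^+)\setminus H^2_0(\mathbb{R}^+)$ let $A_{v,\ell}$ be the operator $$\mathcal{D}(A_{v,\ell})=H^2_0(\mathbb{R}^+)\dotplus\operatorname{span}\{v\},\qquad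 f+\lambda v\mapsto iSf+i\lambda(-\ell''+V\ell)\qquad (f\in H^2_0(\mathbb{R}^+),\ \lambda\in\mathbb{C}).$$ Then $A_{v,\ell}$ is maximally dissipative (equivalently, $-iA_{v,\ell}$ is maximally accretive) if and only if $v\in H^1(\mathbb{R}^+)$ and $$\operatorname{Re}\left(\overline{v(0)}\,\ell'(0)\right)-\frac{\eta'(0)}{4}|v(0)|^2\ \ge\ \frac14\left(\|v'-\ell'\|^2+\int_0^\infty|v(x)-\ell(x)|^2V(x)\,dx\right).\qquad(*)$$ Moreover, the maximally accretive extensions of $S$ are exactly the operators $-iA_{v,\ell}$ with $v\in H^1(\mathbb{R}^+)\setminus H^2_0(\mathbb{R}^+)$ and $\ell\in\mathcal{D}(S_F)$ satisfying $(*)$. -/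

import Mathlib

open MeasureTheory Set Filter Topology
open scoped ENNReal ContDiff InnerProductSpace

/-! ## Dissipative and accretive operators on a complex Hilbert space -/

section Operators

variable {H : Type*} [NormedAddCommGroup H] [InnerProductSpace ℂ H]

/-- A densely defined operator `A` is dissipative if `Im ⟨f, A f⟩ ≥ 0` on its domain
(the inner product is linear in the second entry). -/
def IsDissipative (A : H →ₗ.[ℂ] H) : Prop :=
  Dense (A.domain : Set H) ∧ ∀ f : A.domain, 0 ≤ (⟪(f : H), A f⟫_ℂ).im

/-- A dissipative operator without non-trivial dissipative extensions (`A ≤ B` means that the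
operator `B` extends `A`). -/
def IsMaximallyDissipative (A : H →ₗ.[ℂ] H) : Prop :=
  IsDissipative A ∧ ∀ B : H →ₗ.[ℂ] H, IsDissipative B → A ≤ B → B = A

/-- `A` is maximally accretive if `i A` is maximally dissipative. -/
def IsMaximallyAccretive (A : H →ₗ.[ℂ] H) : Prop :=
  IsMaximallyDissipative (Complex.I • A)

/-- The form domain of the Friedrichs extension of a (strictly positive symmetric) operator `S`:
the domain of the closure of the quadratic form `f ↦ ⟨f, S f⟩` with domain `D(S)`. -/
def friedrichsFormDomain (S : H →ₗ.[ℂ] H) : Set H :=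
  {f | ∃ u : ℕ → S.domain, Tendsto (fun n => (u n : H)) atTop (𝓝 f) ∧
    Tendsto (fun p : ℕ × ℕ => ⟪((u p.1 - u p.2 : S.domain) : H), S (u p.1 - u p.2)⟫_ℂ)
      atTop (𝓝 0)}

/-- The graph relation `ℓ ∈ D(S_F)` and `S_F ℓ = w` of the Friedrichs extension `S_F` of a
(strictly positive symmetric) operator `S`: it is the restriction of the adjoint `S^*` to those
vectors of `D(S^*)` that lie in the domain of the closed form. -/
def FriedrichsGraph (S : H →ₗ.[ℂ] H) (l w : H) : Prop :=
  l ∈ friedrichsFormDomain S ∧ ∀ f : S.domain, ⟪w, (f : H)⟫_ℂ = ⟪l, S f⟫_ℂ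

end Operators

/-! ## Sobolev spaces on the half-line `ℝ⁺ = (0, ∞)` -/

namespace HalfLine

/-- Lebesgue measure on `ℝ⁺ = (0, ∞)`. -/
noncomputable abbrev vol : Measure ℝ := volume.restrict (Ioi (0 : ℝ))

/-- The complex Hilbert space `L²(ℝ⁺)`. -/
noncomputable abbrev L2 : Type := Lp ℂ 2 vol

/-- The space of real potentials `L^∞(ℝ⁺)`. -/
noncomputable abbrev LInf : Type := Lp ℝ ∞ vol

/-- `g ∈ L²(ℝ⁺)` is the weak derivative of `f ∈ L²(ℝ⁺)`, tested against `C_c^∞((0, ∞))`. -/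
def HasWeakDeriv (f g : L2) : Prop :=
  ∀ φ : ℝ → ℝ, ContDiff ℝ ∞ φ → HasCompactSupport φ → tsupport φ ⊆ Ioi 0 →
    ∫ x in Ioi (0 : ℝ), deriv φ x • f x = -∫ x in Ioi (0 : ℝ), φ x • g x

/-- `f(0) = c`, in the sense that the representative of `f` that is continuous on `[0, ∞)` takes
the value `c` at `0`. -/
def HasTrace (f : L2) (c : ℂ) : Prop :=
  ∃ F : ℝ → ℂ, ContinuousOn F (Ici 0) ∧ (f : ℝ → ℂ) =ᵐ[vol] F ∧ F 0 = c

theorem integrable_test_smul {φ : ℝ → ℝ} (hc : Continuous φ) (hs : HasCompactSupport φ) (f : L2) :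
    Integrable (fun x => φ x • f x) vol :=
  memLp_one_iff_integrable.1
    ((Lp.memLp f).smul (p := 2) (r := 1) (hc.memLp_of_hasCompactSupport hs))

theorem HasWeakDeriv.zero : HasWeakDeriv 0 0 := by
  intro φ _ _ _
  have h (ψ : ℝ → ℝ) : ∫ x in Ioi (0 : ℝ), ψ x • (0 : L2) x = 0 := by
    rw [integral_eq_zero_of_ae]
    filter_upwards [Lp.coeFn_zero ℂ 2 vol] with x hx
    rw [hx]
    exact smul_zero _
  rw [h, h, neg_zero]

theorem HasWeakDeriv.add {f₁ g₁ f₂ g₂ : L2} (h₁ : HasWeakDeriv f₁ g₁) (h₂ : HasWeakDeriv f₂ g₂) :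
    HasWeakDeriv (f₁ + f₂) (g₁ + g₂) := by
  intro φ hφ hs ht
  have key (ψ : ℝ → ℝ) (hc : Continuous ψ) (hψ : HasCompactSupport ψ) (a b : L2) :
      ∫ x in Ioi (0 : ℝ), ψ x • (a + b : L2) x =
        (∫ x in Ioi (0 : ℝ), ψ x • a x) + ∫ x in Ioi (0 : ℝ), ψ x • b x := by
    rw [← integral_add (integrable_test_smul hc hψ a) (integrable_test_smul hc hψ b)]
    refine integral_congr_ae ?_
    filter_upwards [Lp.coeFn_add a b] with x hx
    simp only [hx, Pi.add_apply, smul_add]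
  rw [key _ (hφ.continuous_deriv (by simp)) hs.deriv, key _ hφ.continuous hs, h₁ φ hφ hs ht,
    h₂ φ hφ hs ht, neg_add]

theorem HasWeakDeriv.smul {f g : L2} (c : ℂ) (h : HasWeakDeriv f g) :
    HasWeakDeriv (c • f) (c • g) := by
  intro φ hφ hs ht
  have key (ψ : ℝ → ℝ) (a : L2) :
      ∫ x in Ioi (0 : ℝ), ψ x • (c • a : L2) x = c • ∫ x in Ioi (0 : ℝ), ψ x • a x := by
    rw [← integral_smul]
    refine integral_congr_ae ?_
    filter_upwards [Lp.coeFn_smul c a] with x hx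
    simp only [hx, Pi.smul_apply]
    exact smul_comm _ _ _
  rw [key, key, h φ hφ hs ht, smul_neg]

theorem HasWeakDeriv.unique {f g₁ g₂ : L2} (h₁ : HasWeakDeriv f g₁) (h₂ : HasWeakDeriv f g₂) :
    g₁ = g₂ := by
  have hloc (g : L2) : LocallyIntegrable (g : ℝ → ℂ) vol :=
    (Lp.memLp g).locallyIntegrable (by norm_num)
  have h0 : ∀ᵐ x ∂(vol : Measure ℝ), x ∈ Ioi (0 : ℝ) → (g₁ x - g₂ x) = 0 := by
    refine isOpen_Ioi.ae_eq_zero_of_integral_contDiff_smul_eq_zero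
      (((hloc g₁).sub (hloc g₂)).locallyIntegrableOn _) ?_
    intro φ hφ hs ht
    have e : ∫ x in Ioi (0 : ℝ), φ x • g₁ x = ∫ x in Ioi (0 : ℝ), φ x • g₂ x :=
      neg_injective ((h₁ φ hφ hs ht).symm.trans (h₂ φ hφ hs ht))
    simp only [smul_sub]
    rw [integral_sub (integrable_test_smul hφ.continuous hs g₁)
      (integrable_test_smul hφ.continuous hs g₂), e, sub_self]
  refine Lp.ext ?_
  filter_upwards [h0, ae_restrict_mem measurableSet_Ioi] with x hx hx'
  exact sub_eq_zero.1 (hx hx')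

theorem HasTrace.zero : HasTrace 0 0 :=
  ⟨fun _ => 0, continuousOn_const, Lp.coeFn_zero ℂ 2 vol, rfl⟩

theorem HasTrace.add {f₁ f₂ : L2} {c₁ c₂ : ℂ} (h₁ : HasTrace f₁ c₁) (h₂ : HasTrace f₂ c₂) :
    HasTrace (f₁ + f₂) (c₁ + c₂) := by
  obtain ⟨F₁, hF₁, e₁, rfl⟩ := h₁
  obtain ⟨F₂, hF₂, e₂, rfl⟩ := h₂
  refine ⟨F₁ + F₂, hF₁.add hF₂, ?_, rfl⟩
  filter_upwards [Lp.coeFn_add f₁ f₂, e₁, e₂] with x hx h1 h2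
  rw [hx, Pi.add_apply, Pi.add_apply, h1, h2]

theorem HasTrace.smul {f : L2} {c : ℂ} (a : ℂ) (h : HasTrace f c) : HasTrace (a • f) (a • c) := by
  obtain ⟨F, hF, e, rfl⟩ := h
  refine ⟨a • F, hF.const_smul a, ?_, rfl⟩
  filter_upwards [Lp.coeFn_smul a f, e] with x hx h1
  rw [hx, Pi.smul_apply, Pi.smul_apply, h1]

theorem HasTrace.unique {f : L2} {c₁ c₂ : ℂ} (h₁ : HasTrace f c₁) (h₂ : HasTrace f c₂) :
    c₁ = c₂ := by
  obtain ⟨F₁, hF₁, e₁, rfl⟩ := h₁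
  obtain ⟨F₂, hF₂, e₂, rfl⟩ := h₂
  have e : F₁ =ᵐ[volume.restrict (Ioi (0 : ℝ))] F₂ := e₁.symm.trans e₂
  have heq : EqOn F₁ F₂ (Ioi 0) :=
    Measure.eqOn_open_of_ae_eq e isOpen_Ioi (hF₁.mono Ioi_subset_Ici_self)
      (hF₂.mono Ioi_subset_Ici_self)
  exact heq.of_subset_closure hF₁ hF₂ Ioi_subset_Ici_self (by rw [closure_Ioi])
    (mem_Ici.2 le_rfl)

open Classical in
/-- The weak derivative `f'` of `f` (and `0` if `f ∉ H¹(ℝ⁺)`). -/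
noncomputable def weakDeriv (f : L2) : L2 :=
  if h : ∃ g, HasWeakDeriv f g then h.choose else 0

open Classical in
/-- The boundary value `f(0)` of `f` (and `0` if `f` has no representative that is continuous on
`[0, ∞)`). -/
noncomputable def trace (f : L2) : ℂ :=
  if h : ∃ c, HasTrace f c then h.choose else 0

theorem HasWeakDeriv.weakDeriv_eq {f g : L2} (h : HasWeakDeriv f g) : weakDeriv f = g := by
  have hex : ∃ g, HasWeakDeriv f g := ⟨g, h⟩
  rw [weakDeriv, dif_pos hex]
  exact hex.choose_spec.unique h

theorem HasTrace.trace_eq {f : L2} {c : ℂ} (h : HasTrace f c) : trace f = c := by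
  have hex : ∃ c, HasTrace f c := ⟨c, h⟩
  rw [trace, dif_pos hex]
  exact hex.choose_spec.unique h

/-- The Sobolev space `H¹(ℝ⁺)`. -/
def H1 : Submodule ℂ L2 where
  carrier := {f | ∃ g, HasWeakDeriv f g}
  zero_mem' := ⟨0, .zero⟩
  add_mem' := by
    rintro _ _ ⟨g₁, h₁⟩ ⟨g₂, h₂⟩
    exact ⟨_, h₁.add h₂⟩
  smul_mem' := by
    rintro c _ ⟨g, h⟩
    exact ⟨_, h.smul c⟩

/-- The Sobolev space `H²(ℝ⁺)`. -/
def H2 : Submodule ℂ L2 where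
  carrier := {f | ∃ g h, HasWeakDeriv f g ∧ HasWeakDeriv g h}
  zero_mem' := ⟨0, 0, .zero, .zero⟩
  add_mem' := by
    rintro _ _ ⟨g₁, k₁, h₁, h₁'⟩ ⟨g₂, k₂, h₂, h₂'⟩
    exact ⟨_, _, h₁.add h₂, h₁'.add h₂'⟩
  smul_mem' := by
    rintro c _ ⟨g, k, h, h'⟩
    exact ⟨_, _, h.smul c, h'.smul c⟩

/-- The space `H²₀(ℝ⁺) = {f ∈ H²(ℝ⁺) : f(0) = f'(0) = 0}`. -/
def H20 : Submodule ℂ L2 where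
  carrier := {f | f ∈ H2 ∧ HasTrace f 0 ∧ HasTrace (weakDeriv f) 0}
  zero_mem' := ⟨H2.zero_mem, .zero, by rw [HasWeakDeriv.zero.weakDeriv_eq]; exact .zero⟩
  add_mem' := by
    rintro f₁ f₂ ⟨m₁, t₁, t₁'⟩ ⟨m₂, t₂, t₂'⟩
    refine ⟨H2.add_mem m₁ m₂, by simpa using t₁.add t₂, ?_⟩
    obtain ⟨g₁, k₁, h₁, -⟩ := m₁
    obtain ⟨g₂, k₂, h₂, -⟩ := m₂
    rw [h₁.weakDeriv_eq] at t₁'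
    rw [h₂.weakDeriv_eq] at t₂'
    rw [(h₁.add h₂).weakDeriv_eq]
    simpa using t₁'.add t₂'
  smul_mem' := by
    rintro c f ⟨m, t, t'⟩
    refine ⟨H2.smul_mem c m, by simpa using t.smul c, ?_⟩
    obtain ⟨g, k, h, -⟩ := m
    rw [h.weakDeriv_eq] at t'
    rw [(h.smul c).weakDeriv_eq]
    simpa using t'.smul c

/-! ## The Schrödinger operator -/

theorem potential_smul_comm (V : LInf) (c : ℂ) (f : L2) :
    (V • (c • f) : L2) = c • (V • f : L2) := by
  refine Lp.ext ?_
  filter_upwards [Lp.coeFn_lpSMul (r := 2) V (c • f), Lp.coeFn_smul c (V • f : L2),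
    Lp.coeFn_lpSMul (r := 2) V f, Lp.coeFn_smul c f] with x h1 h2 h3 h4
  rw [h1, h2, Pi.smul_apply', Pi.smul_apply, h4, h3, Pi.smul_apply, Pi.smul_apply']
  exact smul_comm _ _ _

/-- The differential expression `f ↦ -f'' + V f`, for `f ∈ H²(ℝ⁺)`. -/
noncomputable def schrodinger (V : LInf) (f : L2) : L2 :=
  -weakDeriv (weakDeriv f) + V • f

theorem schrodinger_add (V : LInf) {f₁ f₂ : L2} (m₁ : f₁ ∈ H2) (m₂ : f₂ ∈ H2) :
    schrodinger V (f₁ + f₂) = schrodinger V f₁ + schrodinger V f₂ := by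
  obtain ⟨g₁, k₁, h₁, h₁'⟩ := m₁
  obtain ⟨g₂, k₂, h₂, h₂'⟩ := m₂
  rw [schrodinger, schrodinger, schrodinger, (h₁.add h₂).weakDeriv_eq,
    (h₁'.add h₂').weakDeriv_eq, h₁.weakDeriv_eq, h₁'.weakDeriv_eq, h₂.weakDeriv_eq,
    h₂'.weakDeriv_eq, Lp.add_smul]
  abel

theorem schrodinger_smul (V : LInf) (c : ℂ) {f : L2} (m : f ∈ H2) :
    schrodinger V (c • f) = c • schrodinger V f := by
  obtain ⟨g, k, h, h'⟩ := m
  rw [schrodinger, schrodinger, (h.smul c).weakDeriv_eq, (h'.smul c).weakDeriv_eq,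
    h.weakDeriv_eq, h'.weakDeriv_eq, smul_add, smul_neg, potential_smul_comm]

/-- The symmetric operator `S f = -f'' + V f` with domain `D(S) = H²₀(ℝ⁺)`. -/
noncomputable def S (V : LInf) : L2 →ₗ.[ℂ] L2 where
  domain := H20
  toFun :=
    { toFun := fun f => schrodinger V f
      map_add' := fun f g => schrodinger_add V f.2.1 g.2.1
      map_smul' := fun c f => schrodinger_smul V c f.2.1 }

/-- The operator `A_{v,ℓ}` with domain `H²₀(ℝ⁺) ∔ span {v}`, mapping `f + λ v` to
`i S f + i λ (-ℓ'' + V ℓ)`. -/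
noncomputable def Aop (V : LInf) (v l : L2) (hv : v ∉ H20) : L2 →ₗ.[ℂ] L2 :=
  (Complex.I • S V).supSpanSingleton v (Complex.I • schrodinger V l) hv

/-- `η ∈ H²(ℝ⁺)` solves `η'' = V η`, `η(0) = 1`. -/
def IsEta (V : LInf) (η : L2) : Prop :=
  η ∈ H2 ∧ weakDeriv (weakDeriv η) = V • η ∧ HasTrace η 1

/-- The inequality
`Re (conj v(0) * ℓ'(0)) - η'(0) / 4 * |v(0)|² ≥ (‖v' - ℓ'‖² + ∫ |v - ℓ|² V) / 4`
(the number `η'(0)` is real). -/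
def Condition (V : LInf) (η v l : L2) : Prop :=
  (star (trace v) * trace (weakDeriv l)).re - (trace (weakDeriv η)).re / 4 * ‖trace v‖ ^ 2 ≥
    1 / 4 * (‖weakDeriv v - weakDeriv l‖ ^ 2 + ∫ x in Ioi (0 : ℝ), ‖v x - l x‖ ^ 2 * V x)

end HalfLine

/-! Write `a(f, h) = ⟨f', h'⟩ + ⟨f, V h⟩` for the energy form, `q(g) = a(g, g)` and `M = Re ⟨v, S_F
ℓ⟩`. After scaling, a vector of the domain of `A_{v,ℓ}` outside `H²₀` is `v - g` with `g ∈ H²₀`, and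
dissipativity becomes the family of inequalities `Re ⟨v + ℓ, S g⟩ ≤ q(g) + M`
(`isDissipative_Aop_iff`).

These bound the functional `g ↦ ⟨v + ℓ, S g⟩` in the `H¹` norm. Its representation through `a` by
some `w ∈ H¹₀` makes `v + ℓ - w` orthogonal to the range of `S`, hence a multiple of `η`; so `v ∈
H¹` (`mem_H1_of_forall_le`). Taking traces gives `w = v + ℓ - v(0) η`, and `⟨v + ℓ, S g⟩ = a(w, g)`.
Completing the square, with `H²₀` dense in `H¹₀` for the energy norm, turns the family into `q(w) /
4 ≤ M` (`forall_re_inner_le_iff`). Green's formula and `a(η, f) = -f(0) η'(0)` rewrite this as the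
stated inequality (`condition_iff`).

Maximality is automatic. `S` has defect one, and adding one vector to its domain makes `-i A_{v,ℓ} +
1` onto (`exists_resolvent_eq`), which leaves no room for a dissipative extension. Conversely, a
maximally accretive extension `T` of `S` has a domain vector `v ∉ H²₀`. As `S_F` is onto, `T v = S_F
ℓ` for some `ℓ`; then `i T` extends the dissipative, hence maximal, operator `A_{v,ℓ}`, so they
coincide. -/

namespace HalfLine

/-! ## Test functions -/

/-- `φ ∈ C_c^∞((0, ∞))`. -/
structure IsTest (φ : ℝ → ℝ) : Prop where
  contDiff : ContDiff ℝ ∞ φ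
  compact : HasCompactSupport φ
  tsupport_subset : tsupport φ ⊆ Ioi 0

theorem IsTest.continuous {φ : ℝ → ℝ} (h : IsTest φ) : Continuous φ := h.contDiff.continuous

theorem IsTest.hasDerivAt {φ : ℝ → ℝ} (h : IsTest φ) (x : ℝ) : HasDerivAt φ (deriv φ x) x :=
  (h.contDiff.differentiable (by simp) x).hasDerivAt

theorem IsTest.eq_zero {φ : ℝ → ℝ} (h : IsTest φ) {x : ℝ} (hx : x ≤ 0) : φ x = 0 :=
  image_eq_zero_of_notMem_tsupport fun hm => absurd (h.tsupport_subset hm) (not_lt.2 hx)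

theorem IsTest.isTest_deriv {φ : ℝ → ℝ} (h : IsTest φ) : IsTest (deriv φ) :=
  ⟨(contDiff_infty_iff_deriv.1 h.contDiff).2, h.compact.deriv,
    tsupport_deriv_subset.trans h.tsupport_subset⟩

theorem IsTest.mul_left {φ w : ℝ → ℝ} (h : IsTest φ) (hw : ContDiff ℝ ∞ w) :
    IsTest (fun x => w x * φ x) :=
  ⟨hw.mul h.contDiff, h.compact.mul_left, (tsupport_mul_subset_right).trans h.tsupport_subset⟩

theorem IsTest.sub {φ ψ : ℝ → ℝ} (h : IsTest φ) (h' : IsTest ψ) :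
    IsTest (fun x => φ x - ψ x) :=
  ⟨h.contDiff.sub h'.contDiff, h.compact.sub h'.compact,
    (tsupport_sub φ ψ).trans (union_subset h.tsupport_subset h'.tsupport_subset)⟩

theorem IsTest.memLp {φ : ℝ → ℝ} (h : IsTest φ) : MemLp (fun x => (φ x : ℂ)) 2 vol :=
  (Complex.continuous_ofReal.comp h.continuous).memLp_of_hasCompactSupport
    (h.compact.comp_left Complex.ofReal_zero)

/-- A test function as an element of `L²(ℝ⁺)`. -/
noncomputable def testLp {φ : ℝ → ℝ} (h : IsTest φ) : L2 := h.memLp.toLp _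

theorem coeFn_testLp {φ : ℝ → ℝ} (h : IsTest φ) :
    (testLp h : ℝ → ℂ) =ᵐ[vol] fun x => (φ x : ℂ) := h.memLp.coeFn_toLp

theorem inner_testLp {φ : ℝ → ℝ} (h : IsTest φ) (f : L2) :
    ⟪testLp h, f⟫_ℂ = ∫ x in Ioi (0 : ℝ), φ x • f x := by
  rw [L2.inner_def]
  refine integral_congr_ae ?_
  filter_upwards [coeFn_testLp h] with x hx
  rw [hx, RCLike.inner_apply, Complex.conj_ofReal, mul_comm, Complex.real_smul]

theorem hasWeakDeriv_iff {f g : L2} : HasWeakDeriv f g ↔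
    ∀ (φ : ℝ → ℝ) (h : IsTest φ), ⟪testLp h.isTest_deriv, f⟫_ℂ = -⟪testLp h, g⟫_ℂ := by
  simp only [inner_testLp]
  exact ⟨fun H φ h => H φ h.1 h.2 h.3, fun H φ h1 h2 h3 => H φ ⟨h1, h2, h3⟩⟩

theorem IsTest.setIntegral_eq {φ : ℝ → ℝ} (h : IsTest φ) (w : ℝ → ℝ) :
    ∫ x in Ioi (0 : ℝ), φ x * w x = ∫ x, φ x * w x :=
  setIntegral_eq_integral_of_forall_compl_eq_zero fun x hx => by
    rw [h.eq_zero (not_lt.1 hx), zero_mul]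

theorem IsTest.integral_deriv_mul {φ w w' : ℝ → ℝ} (h : IsTest φ)
    (hw : ∀ x, HasDerivAt w (w' x) x) (hw' : Continuous w') :
    ∫ x in Ioi (0 : ℝ), deriv φ x * w x = -∫ x in Ioi (0 : ℝ), φ x * w' x := by
  have hc : Continuous w := continuous_iff_continuousAt.2 fun x => (hw x).continuousAt
  have i1 : Integrable (φ * w') volume :=
    (h.continuous.mul hw').integrable_of_hasCompactSupport h.compact.mul_right
  have i2 : Integrable (deriv φ * w) volume :=
    (h.isTest_deriv.continuous.mul hc).integrable_of_hasCompactSupport h.isTest_deriv.compact.mul_right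
  have i3 : Integrable (φ * w) volume :=
    (h.continuous.mul hc).integrable_of_hasCompactSupport h.compact.mul_right
  rw [h.setIntegral_eq, h.isTest_deriv.setIntegral_eq,
    integral_mul_deriv_eq_deriv_mul_of_integrable (fun x _ => h.hasDerivAt x) (fun x _ => hw x)
      i1 i2 i3, neg_neg]

theorem hasWeakDeriv_of_hasDerivAt {f g : L2} {w w' : ℝ → ℝ}
    (hf : (f : ℝ → ℂ) =ᵐ[vol] fun x => (w x : ℂ)) (hg : (g : ℝ → ℂ) =ᵐ[vol] fun x => (w' x : ℂ))
    (hw : ∀ x, HasDerivAt w (w' x) x) (hw' : Continuous w') : HasWeakDeriv f g := by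
  intro φ h1 h2 h3
  have e (ψ u : ℝ → ℝ) (k : L2) (hk : (k : ℝ → ℂ) =ᵐ[vol] fun x => (u x : ℂ)) :
      ∫ x in Ioi (0 : ℝ), ψ x • k x = ((∫ x in Ioi (0 : ℝ), ψ x * u x : ℝ) : ℂ) := by
    rw [← integral_complex_ofReal]
    refine integral_congr_ae ?_
    filter_upwards [hk] with x hx
    rw [hx, Complex.real_smul]
    exact (Complex.ofReal_mul _ _).symm
  rw [e _ _ _ hf, e _ _ _ hg, IsTest.integral_deriv_mul ⟨h1, h2, h3⟩ hw hw', Complex.ofReal_neg]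

theorem hasWeakDeriv_testLp {φ : ℝ → ℝ} (h : IsTest φ) :
    HasWeakDeriv (testLp h) (testLp h.isTest_deriv) :=
  hasWeakDeriv_of_hasDerivAt (coeFn_testLp h) (coeFn_testLp h.isTest_deriv) h.hasDerivAt
    h.isTest_deriv.continuous

theorem eq_zero_of_inner_testLp {f : L2} (H : ∀ (φ : ℝ → ℝ) (h : IsTest φ), ⟪testLp h, f⟫_ℂ = 0) :
    f = 0 := by
  have h0 : ∀ᵐ x ∂(vol : Measure ℝ), x ∈ Ioi (0 : ℝ) → f x = 0 := by
    refine isOpen_Ioi.ae_eq_zero_of_integral_contDiff_smul_eq_zero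
      (((Lp.memLp f).locallyIntegrable (by norm_num)).locallyIntegrableOn _) ?_
    intro φ h1 h2 h3
    rw [← inner_testLp ⟨h1, h2, h3⟩]
    exact H _ _
  refine Lp.ext ?_
  filter_upwards [h0, ae_restrict_mem measurableSet_Ioi, Lp.coeFn_zero ℂ 2 vol] with x hx hx' h
  rw [hx hx', h, Pi.zero_apply]

/-! ## Functions with vanishing weak derivative -/

theorem IsTest.exists_Icc {φ : ℝ → ℝ} (h : IsTest φ) : ∃ a b : ℝ, 0 < a ∧ tsupport φ ⊆ Icc a b := by
  rcases (tsupport φ).eq_empty_or_nonempty with he | hne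
  · exact ⟨1, 1, one_pos, by simp [he]⟩
  · obtain ⟨a, ha, ha'⟩ := h.compact.isCompact.exists_isLeast hne
    obtain ⟨b, hb, hb'⟩ := h.compact.isCompact.exists_isGreatest hne
    exact ⟨a, b, h.tsupport_subset ha, fun x hx => ⟨ha' hx, hb' hx⟩⟩

/-- A test function with vanishing integral is the derivative of a test function. -/
theorem IsTest.exists_primitive {θ : ℝ → ℝ} (h : IsTest θ) (h0 : ∫ x, θ x = 0) :
    ∃ ψ, IsTest ψ ∧ deriv ψ = θ := by
  obtain ⟨a, b, ha, hab⟩ := h.exists_Icc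
  have hz {x : ℝ} (hx : x ∉ Icc a b) : θ x = 0 :=
    image_eq_zero_of_notMem_tsupport fun hm => hx (hab hm)
  have hi (c d : ℝ) : IntervalIntegrable θ volume c d := h.continuous.intervalIntegrable c d
  have hd (x : ℝ) : HasDerivAt (fun x => ∫ t in a..x, θ t) (θ x) x :=
    intervalIntegral.integral_hasDerivAt_right (hi a x)
      (h.continuous.stronglyMeasurableAtFilter _ _) h.continuous.continuousAt
  have hde : deriv (fun x => ∫ t in a..x, θ t) = θ := funext fun x => (hd x).deriv
  have hsupp : Function.support (fun x => ∫ t in a..x, θ t) ⊆ Icc a b := by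
    intro x hx
    by_contra hn
    apply hx
    -- To the left of the support the primitive is zero trivially; to the right it equals the full
    -- integral, which vanishes by `h0`.
    rcases lt_or_ge x a with hxa | hxa
    · refine intervalIntegral.integral_zero_ae ?_
      have : ∀ᵐ t : ℝ, t ≠ a := by simp [ae_iff]
      filter_upwards [this] with t ht hm
      rw [uIoc_of_ge hxa.le] at hm
      exact hz fun hm' => ht (le_antisymm hm.2 hm'.1)
    · have hbx : b < x := not_le.1 fun hxb => hn ⟨hxa, hxb⟩
      have : ∫ t in a..x, θ t = ∫ t, θ t := by
        rw [intervalIntegral.integral_of_le hxa, ← integral_Icc_eq_integral_Ioc]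
        exact setIntegral_eq_integral_of_forall_compl_eq_zero fun t ht =>
          hz fun hm => ht ⟨hm.1, hm.2.trans hbx.le⟩
      change ∫ t in a..x, θ t = 0
      rw [this, h0]
  have hts : tsupport (fun x => ∫ t in a..x, θ t) ⊆ Icc a b :=
    closure_minimal hsupp isClosed_Icc
  refine ⟨fun x => ∫ t in a..x, θ t, ⟨?_, ?_, hts.trans fun x hx => ha.trans_le hx.1⟩, hde⟩
  · exact contDiff_infty_iff_deriv.2 ⟨fun x => (hd x).differentiableAt, by rw [hde]; exact h.1⟩
  · exact HasCompactSupport.of_support_subset_isCompact isCompact_Icc hsupp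

theorem exists_isTest_integral_one : ∃ ρ, IsTest ρ ∧ ∫ x, ρ x = 1 := by
  let f : ContDiffBump (1 : ℝ) := ⟨1 / 4, 1 / 2, by norm_num, by norm_num⟩
  refine ⟨f.normed volume, ⟨f.contDiff_normed, f.hasCompactSupport_normed, ?_⟩,
    f.integral_normed⟩
  rw [f.tsupport_normed_eq, Real.closedBall_eq_Icc]
  intro x hx
  have : (1 : ℝ) - 1 / 2 ≤ x := hx.1
  exact lt_of_lt_of_le (by norm_num) this

/-- The du Bois-Reymond argument: for a fixed `ρ` of integral one, `χ - (∫ χ) ρ` has integral zero,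
so it is the derivative of a test function and is annihilated by `M`. The constant is therefore the
`ρ`-average of `M`. -/
theorem ae_eq_const_of_integral_deriv_eq_zero {M : ℝ → ℂ} (hM : LocallyIntegrable M vol)
    (h0 : ∀ ψ, IsTest ψ → ∫ x in Ioi (0 : ℝ), deriv ψ x • M x = 0) :
    ∃ C : ℂ, M =ᵐ[vol] fun _ => C := by
  obtain ⟨ρ, hρ, hρ1⟩ := exists_isTest_integral_one
  have hint {χ : ℝ → ℝ} (hχ : IsTest χ) {N : ℝ → ℂ} (hN : LocallyIntegrable N vol) :
      Integrable (fun x => χ x • N x) vol :=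
    hN.integrable_smul_left_of_hasCompactSupport hχ.continuous hχ.compact
  have hreal {χ : ℝ → ℝ} (hχ : IsTest χ) : ∫ x in Ioi (0 : ℝ), χ x = ∫ x, χ x := by
    simpa using hχ.setIntegral_eq (fun _ => 1)
  set C : ℂ := ∫ x in Ioi (0 : ℝ), ρ x • M x with hC
  have hcl : LocallyIntegrable (fun _ : ℝ => C) vol := continuous_const.locallyIntegrable
  refine ⟨C, ?_⟩
  have key : ∀ᵐ x ∂(vol : Measure ℝ), x ∈ Ioi (0 : ℝ) → M x - C = 0 := by
    refine isOpen_Ioi.ae_eq_zero_of_integral_contDiff_smul_eq_zero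
      ((hM.sub hcl).locallyIntegrableOn _) ?_
    intro χ h1 h2 h3
    have hχ : IsTest χ := ⟨h1, h2, h3⟩
    set I : ℝ := ∫ x, χ x with hI
    have hρI : IsTest (fun x => I * ρ x) := hρ.mul_left contDiff_const
    obtain ⟨ψ, hψ, hd⟩ := (hχ.sub hρI).exists_primitive (by
      rw [integral_sub (hχ.continuous.integrable_of_hasCompactSupport hχ.compact)
        (hρI.continuous.integrable_of_hasCompactSupport hρI.compact), integral_const_mul, hρ1,
        mul_one, sub_self])
    have := h0 ψ hψ
    rw [hd] at this
    simp only [sub_smul] at this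
    rw [integral_sub (hint hχ hM) (hint hρI hM), sub_eq_zero] at this
    simp only [smul_sub]
    rw [integral_sub (hint hχ hM) (hint hχ hcl), this, integral_smul_const, hreal hχ]
    simp only [mul_smul]
    rw [integral_smul, ← hC, sub_self]
  filter_upwards [key, ae_restrict_mem measurableSet_Ioi] with x hx hx'
  exact sub_eq_zero.1 (hx hx')

/-- The integrating factor `exp (-s x)` reduces the equation `m' = s m` to a vanishing weak
derivative; the factor is moved onto the test function. -/
theorem ae_eq_exp_of_hasWeakDeriv_smul {m : L2} {s : ℝ} (h : HasWeakDeriv m ((s : ℂ) • m)) :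
    ∃ C : ℂ, (m : ℝ → ℂ) =ᵐ[vol] fun x => Real.exp (s * x) • C := by
  have hw : ContDiff ℝ ∞ fun x => Real.exp (-s * x) := by fun_prop
  have hm : LocallyIntegrable (m : ℝ → ℂ) vol := (Lp.memLp m).locallyIntegrable (by norm_num)
  have hloc : LocallyIntegrable (fun x => Real.exp (-s * x) • m x) vol := by
    rw [← locallyIntegrableOn_univ] at hm ⊢
    exact hm.continuousOn_smul isOpen_univ.isLocallyClosed hw.continuous.continuousOn
  obtain ⟨C, hC⟩ := ae_eq_const_of_integral_deriv_eq_zero hloc (by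
    intro ψ hψ
    have hφ := hψ.mul_left hw
    have hd : deriv (fun x => Real.exp (-s * x) * ψ x) =
        fun x => Real.exp (-s * x) * deriv ψ x + -s * (Real.exp (-s * x) * ψ x) := by
      funext x
      have h1 : HasDerivAt (fun x => Real.exp (-s * x)) (Real.exp (-s * x) * -s) x := by
        simpa using ((hasDerivAt_id x).const_mul (-s)).exp
      refine (h1.mul (hψ.hasDerivAt x)).deriv.trans ?_
      ring
    have := h _ hφ.1 hφ.2 hφ.3
    rw [hd] at this
    simp only [add_smul] at this
    rw [integral_add (integrable_test_smul (hψ.isTest_deriv.mul_left hw).continuous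
        (hψ.isTest_deriv.mul_left hw).compact m)
      (integrable_test_smul (hφ.mul_left contDiff_const).continuous
        (hφ.mul_left contDiff_const).compact m)] at this
    have e : ∫ x in Ioi (0 : ℝ), (-s * (Real.exp (-s * x) * ψ x)) • m x =
        -∫ x in Ioi (0 : ℝ), (Real.exp (-s * x) * ψ x) • ((s : ℂ) • m : L2) x := by
      rw [← integral_neg]
      refine integral_congr_ae ?_
      filter_upwards [Lp.coeFn_smul (s : ℂ) m] with x hx
      rw [hx, Pi.smul_apply, Complex.real_smul, Complex.real_smul, smul_eq_mul]
      push_cast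
      ring
    rw [e] at this
    have h2 := add_eq_right.1 this
    rw [← h2]
    refine integral_congr_ae (Eventually.of_forall fun x => ?_)
    simp only [smul_smul, mul_comm])
  refine ⟨C, ?_⟩
  filter_upwards [hC] with x hx
  rw [← hx, smul_smul, ← Real.exp_add]
  simp

/-! ## The space `H¹₀(ℝ⁺)` and boundary values -/

/-- The pair `(f, g)` in the Hilbert space `L² ⊕ L²`. -/
noncomputable abbrev pair (f g : L2) : WithLp 2 (L2 × L2) := WithLp.toLp 2 (f, g)

/-- The span of the pairs `(φ, φ')`, for test functions `φ`. -/
noncomputable def testGraph : Submodule ℂ (WithLp 2 (L2 × L2)) :=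
  Submodule.span ℂ {p | ∃ (φ : ℝ → ℝ) (h : IsTest φ), p = pair (testLp h) (testLp h.isTest_deriv)}

/-- The pairs `(f, f')` with `f ∈ H¹₀(ℝ⁺)`, the closure of `C_c^∞(ℝ⁺)` in `H¹(ℝ⁺)`. -/
noncomputable def H10Graph : Submodule ℂ (WithLp 2 (L2 × L2)) := testGraph.topologicalClosure

theorem pair_testLp_mem_testGraph {φ : ℝ → ℝ} (h : IsTest φ) :
    pair (testLp h) (testLp h.isTest_deriv) ∈ testGraph := Submodule.subset_span ⟨φ, h, rfl⟩

theorem pair_testLp_mem {φ : ℝ → ℝ} (h : IsTest φ) :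
    pair (testLp h) (testLp h.isTest_deriv) ∈ H10Graph :=
  testGraph.le_topologicalClosure (pair_testLp_mem_testGraph h)

instance : CompleteSpace H10Graph :=
  (testGraph.isClosed_topologicalClosure).completeSpace_coe

/-- The identity says that `p` is orthogonal to `(k, h)`. This is a closed linear condition, and on
the generators it is the definition of the weak derivative. -/
theorem inner_eq_neg_of_mem_H10Graph {p : WithLp 2 (L2 × L2)} {h k : L2} (hp : p ∈ H10Graph)
    (hk : HasWeakDeriv h k) : ⟪p.fst, k⟫_ℂ = -⟪p.snd, h⟫_ℂ := by
  have hle : H10Graph ≤ (ℂ ∙ pair k h)ᗮ := by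
    refine Submodule.topologicalClosure_minimal _ (Submodule.span_le.2 ?_)
      (Submodule.isClosed_orthogonal _)
    rintro _ ⟨φ, hφ, rfl⟩
    rw [SetLike.mem_coe, Submodule.mem_orthogonal_singleton_iff_inner_left,
      WithLp.prod_inner_apply]
    change ⟪testLp hφ, k⟫_ℂ + ⟪testLp hφ.isTest_deriv, h⟫_ℂ = 0
    rw [hasWeakDeriv_iff.1 hk _ hφ, add_neg_cancel]
  have := hle hp
  rw [Submodule.mem_orthogonal_singleton_iff_inner_left, WithLp.prod_inner_apply] at this
  exact eq_neg_of_add_eq_zero_left this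

theorem hasWeakDeriv_of_mem_H10Graph {p : WithLp 2 (L2 × L2)} (hp : p ∈ H10Graph) :
    HasWeakDeriv p.fst p.snd := by
  refine hasWeakDeriv_iff.2 fun φ h => ?_
  have := congrArg (starRingEnd ℂ) (inner_eq_neg_of_mem_H10Graph hp (hasWeakDeriv_testLp h))
  rwa [map_neg, inner_conj_symm, inner_conj_symm] at this

/-! ### The splitting of `H¹` into `H¹₀` and the line spanned by `exp (-x)`. -/

theorem memLp_exp : MemLp (fun x : ℝ => (Real.exp (-x) : ℂ)) 2 vol := by
  rw [memLp_two_iff_integrable_sq_norm (by fun_prop)]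
  have : IntegrableOn (fun x : ℝ => Real.exp (-2 * x)) (Ioi 0) :=
    integrableOn_exp_mul_Ioi (by norm_num) 0
  refine this.congr (Eventually.of_forall fun x => ?_)
  simp only [Complex.norm_real, Real.norm_eq_abs, Real.abs_exp]
  rw [← Real.exp_nat_mul]
  congr 1
  push_cast
  ring

/-- The function `x ↦ exp (-x)` as an element of `L²(ℝ⁺)`. -/
noncomputable def expLp : L2 := memLp_exp.toLp _

theorem coeFn_expLp : (expLp : ℝ → ℂ) =ᵐ[vol] fun x => (Real.exp (-x) : ℂ) := memLp_exp.coeFn_toLp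

theorem hasTrace_expLp : HasTrace expLp 1 :=
  ⟨_, by fun_prop, coeFn_expLp, by simp⟩

theorem hasWeakDeriv_expLp : HasWeakDeriv expLp (-expLp) := by
  refine hasWeakDeriv_of_hasDerivAt (w := fun x => Real.exp (-x)) (w' := fun x => -Real.exp (-x))
    coeFn_expLp ?_ (fun x => ?_) (by fun_prop)
  · filter_upwards [Lp.coeFn_neg expLp, coeFn_expLp] with x h1 h2
    rw [h1, Pi.neg_apply, h2, Complex.ofReal_neg]
  · simpa using (hasDerivAt_neg x).exp

theorem inner_expLp_self : ⟪expLp, expLp⟫_ℂ = 1 / 2 := by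
  have h : ⟪expLp, expLp⟫_ℂ = ∫ x in Ioi (0 : ℝ), ((Real.exp (-2 * x) : ℝ) : ℂ) := by
    rw [L2.inner_def]
    refine integral_congr_ae ?_
    filter_upwards [coeFn_expLp] with x hx
    rw [hx, RCLike.inner_apply, Complex.conj_ofReal, ← Complex.ofReal_mul, ← Real.exp_add]
    congr 2
    ring
  rw [h, integral_complex_ofReal, integral_exp_mul_Ioi (by norm_num)]
  norm_num

/-- The component `z` of `(f, f')` orthogonal to the graph of `H¹₀` solves `z₁' = z₂`, `z₂' = z₁`.
Then `z₁ + z₂` is a multiple of `exp x`, hence zero in `L²`, and `z₁' = -z₁` leaves only multiples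
of `exp (-x)`. -/
theorem HasWeakDeriv.exists_sub_mem_H10Graph {f g : L2} (h : HasWeakDeriv f g) :
    ∃ c : ℂ, pair (f - c • expLp) (g + c • expLp) ∈ H10Graph := by
  obtain ⟨y, hy, z, hz, hyz⟩ := H10Graph.exists_add_mem_mem_orthogonal (pair f g)
  have hfz : z.fst = f - y.fst := by
    have := congrArg WithLp.fst hyz
    simp only [WithLp.add_fst] at this
    rw [show f = _ from this]; abel
  have hgz : z.snd = g - y.snd := by
    have := congrArg WithLp.snd hyz
    simp only [WithLp.add_snd] at this
    rw [show g = _ from this]; abel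
  have hzd : HasWeakDeriv z.fst z.snd := by
    have := h.add ((hasWeakDeriv_of_mem_H10Graph hy).smul (-1))
    rw [hfz, hgz]
    simpa [sub_eq_add_neg] using this
  -- Orthogonality to all pairs `(φ, φ')` is the weak form of `z₂' = z₁`.
  have hzd' : HasWeakDeriv z.snd z.fst := by
    refine hasWeakDeriv_iff.2 fun φ hφ => ?_
    have := (Submodule.mem_orthogonal _ _).1 hz _ (pair_testLp_mem hφ)
    rw [WithLp.prod_inner_apply] at this
    exact eq_neg_of_add_eq_zero_right this
  have h0 : z.fst + z.snd = 0 := by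
    obtain ⟨C, hC⟩ := ae_eq_exp_of_hasWeakDeriv_smul (m := z.fst + z.snd) (s := 1) (by
      rw [Complex.ofReal_one, one_smul]
      nth_rewrite 2 [add_comm]
      exact hzd.add hzd')
    have hmem : MemLp (fun x : ℝ => Real.exp (1 * x) • C) 2 vol := (Lp.memLp _).ae_eq hC
    have hC0 : C = 0 := by
      by_contra hne
      -- Since `exp x ≥ 1` on the half-line, the constant `C` would be square integrable on a set of
      -- infinite measure.
      have h1 : MemLp (fun _ : ℝ => C) 2 vol := by
        refine hmem.mono aestronglyMeasurable_const ?_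
        filter_upwards [ae_restrict_mem measurableSet_Ioi] with x hx
        rw [norm_smul, Real.norm_eq_abs, Real.abs_exp]
        exact le_mul_of_one_le_left (norm_nonneg _) (Real.one_le_exp (by simpa using hx.le))
      rw [memLp_const_iff (by norm_num) (by norm_num)] at h1
      simp [hne] at h1
    refine Lp.ext ?_
    filter_upwards [hC, Lp.coeFn_zero ℂ 2 vol] with x hx h
    rw [hx, h, hC0, smul_zero, Pi.zero_apply]
  have hs : z.snd = -z.fst := eq_neg_of_add_eq_zero_right h0
  obtain ⟨C, hC⟩ := ae_eq_exp_of_hasWeakDeriv_smul (m := z.fst) (s := -1) (by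
    rw [Complex.ofReal_neg, Complex.ofReal_one, neg_one_smul, ← hs]
    exact hzd)
  have hzE : z.fst = C • expLp := by
    refine Lp.ext ?_
    filter_upwards [hC, Lp.coeFn_smul C expLp, coeFn_expLp] with x h1 h2 h3
    rw [h1, h2, Pi.smul_apply, h3, Complex.real_smul, smul_eq_mul, mul_comm, neg_one_mul]
  refine ⟨C, ?_⟩
  have : pair (f - C • expLp) (g + C • expLp) = y := by
    refine (WithLp.ofLp_injective 2) (Prod.ext ?_ ?_)
    · change f - C • expLp = y.fst
      rw [← hzE, hfz]; abel
    · change g + C • expLp = y.snd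
      rw [← hzE, ← sub_neg_eq_add, ← hs, hgz]; abel
  rwa [this]

/-! ### Continuous representatives, traces and integration by parts. -/

theorem tendsto_setIntegral_Ioc {q : ℕ → L2} {g : L2} (h : Tendsto q atTop (𝓝 g)) (x : ℝ) :
    Tendsto (fun n => ∫ t in Ioc 0 x, q n t ∂vol) atTop (𝓝 (∫ t in Ioc 0 x, g t ∂vol)) := by
  have hfin : vol (Ioc 0 x) ≠ ⊤ :=
    ((measure_mono Ioc_subset_Icc_self).trans_lt isCompact_Icc.measure_lt_top).ne
  simp only [← L2.inner_indicatorConstLp_one measurableSet_Ioc hfin]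
  exact tendsto_const_nhds.inner h

theorem ae_eq_primitive_of_mem_testGraph {p : WithLp 2 (L2 × L2)} (hp : p ∈ testGraph) :
    (p.fst : ℝ → ℂ) =ᵐ[vol] fun x => ∫ t in Ioc 0 x, p.snd t ∂vol := by
  have hfin (x : ℝ) : vol (Ioc 0 x) ≠ ⊤ :=
    ((measure_mono Ioc_subset_Icc_self).trans_lt isCompact_Icc.measure_lt_top).ne
  simp only [← L2.inner_indicatorConstLp_one measurableSet_Ioc (hfin _)]
  induction hp using Submodule.span_induction with
  | mem p hp =>
    obtain ⟨φ, hφ, rfl⟩ := hp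
    change (testLp hφ : ℝ → ℂ) =ᵐ[vol] fun x => ⟪_, testLp hφ.isTest_deriv⟫_ℂ
    simp only [L2.inner_indicatorConstLp_one measurableSet_Ioc (hfin _)]
    filter_upwards [coeFn_testLp hφ, ae_restrict_mem measurableSet_Ioi] with x hx hx0
    rw [hx, setIntegral_congr_ae measurableSet_Ioc
        ((coeFn_testLp hφ.isTest_deriv).mono fun t ht _ => ht), integral_complex_ofReal,
      Measure.restrict_restrict measurableSet_Ioc, inter_eq_left.2 Ioc_subset_Ioi_self,
      ← intervalIntegral.integral_of_le (le_of_lt hx0),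
      intervalIntegral.integral_eq_sub_of_hasDerivAt (fun x _ => hφ.hasDerivAt x)
        (hφ.isTest_deriv.continuous.intervalIntegrable _ _), hφ.eq_zero le_rfl, sub_zero]
  | zero =>
    simp only [WithLp.zero_fst, WithLp.zero_snd, inner_zero_right]
    exact Lp.coeFn_zero ℂ 2 vol
  | add p q _ _ hp hq =>
    simp only [WithLp.add_fst, WithLp.add_snd, inner_add_right]
    filter_upwards [hp, hq, Lp.coeFn_add p.fst q.fst] with x h1 h2 h3
    rw [h3, Pi.add_apply, h1, h2]
  | smul c p _ hp =>
    simp only [WithLp.smul_fst, WithLp.smul_snd, inner_smul_right]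
    filter_upwards [hp, Lp.coeFn_smul c p.fst] with x h1 h3
    rw [h3, Pi.smul_apply, h1, smul_eq_mul]

/-- The continuous representative is `x ↦ ∫₀ˣ p₂`. The formula holds for combinations of test
functions and survives the limit: the integrals converge for every `x`, the functions almost
everywhere along a subsequence. -/
theorem hasTrace_zero_of_mem_H10Graph {p : WithLp 2 (L2 × L2)} (hp : p ∈ H10Graph) :
    HasTrace p.fst 0 := by
  obtain ⟨u, hu, hlim⟩ := mem_closure_iff_seq_limit.1 hp
  have h1 : Tendsto (fun n => (u n).fst) atTop (𝓝 p.fst) :=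
    ((WithLp.prod_continuous_ofLp 2 L2 L2).fst.tendsto p).comp hlim
  have h2 : Tendsto (fun n => (u n).snd) atTop (𝓝 p.snd) :=
    ((WithLp.prod_continuous_ofLp 2 L2 L2).snd.tendsto p).comp hlim
  obtain ⟨ns, hns, hae⟩ := (tendstoInMeasure_of_tendsto_Lp h1).exists_seq_tendsto_ae
  have hint (a b : ℝ) : IntervalIntegrable (p.snd : ℝ → ℂ) vol a b :=
    (((Lp.memLp p.snd).locallyIntegrable (by norm_num)).integrableOn_isCompact
      isCompact_uIcc).intervalIntegrable
  refine ⟨fun x => ∫ t in 0..x, p.snd t ∂vol,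
    (intervalIntegral.continuous_primitive hint 0).continuousOn, ?_, by simp⟩
  have hall : ∀ᵐ x ∂vol, ∀ n, ((u n).fst : ℝ → ℂ) x = ∫ t in Ioc 0 x, (u n).snd t ∂vol :=
    ae_all_iff.2 fun n => ae_eq_primitive_of_mem_testGraph (hu n)
  filter_upwards [hae, hall, ae_restrict_mem measurableSet_Ioi] with x hx hx' hx0
  rw [intervalIntegral.integral_of_le (le_of_lt hx0)]
  refine tendsto_nhds_unique hx ?_
  simp only [hx']
  exact (tendsto_setIntegral_Ioc h2 x).comp hns.tendsto_atTop

theorem HasWeakDeriv.exists_hasTrace {f g : L2} (h : HasWeakDeriv f g) :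
    ∃ c : ℂ, HasTrace f c ∧ pair (f - c • expLp) (g + c • expLp) ∈ H10Graph := by
  obtain ⟨c, hc⟩ := h.exists_sub_mem_H10Graph
  refine ⟨c, ?_, hc⟩
  have := (hasTrace_zero_of_mem_H10Graph hc).add (hasTrace_expLp.smul c)
  simpa using this

theorem HasWeakDeriv.sub_mem_H10Graph {f g : L2} {c : ℂ} (h : HasWeakDeriv f g)
    (hc : HasTrace f c) : pair (f - c • expLp) (g + c • expLp) ∈ H10Graph := by
  obtain ⟨c', h1, h2⟩ := h.exists_hasTrace
  rwa [hc.unique h1]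

theorem HasWeakDeriv.mem_H10Graph {f g : L2} (h : HasWeakDeriv f g) (hc : HasTrace f 0) :
    pair f g ∈ H10Graph := by
  simpa using h.sub_mem_H10Graph hc

/-- Integration by parts in `H¹(ℝ⁺)`. -/
theorem HasWeakDeriv.inner_add_inner {f g h k : L2} {a b : ℂ} (hf : HasWeakDeriv f g)
    (hh : HasWeakDeriv h k) (ha : HasTrace f a) (hb : HasTrace h b) :
    ⟪f, k⟫_ℂ + ⟪g, h⟫_ℂ = -(star a * b) := by
  -- Without a boundary term, pair the `H¹₀` part of `f` with `h`, then the `H¹₀` part of `h` with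
  -- `exp (-x)`. The boundary term comes only from `‖exp (-x)‖² = 1/2`.
  have h1 := inner_eq_neg_of_mem_H10Graph (hf.sub_mem_H10Graph ha) hh
  have h2 := inner_eq_neg_of_mem_H10Graph (hh.sub_mem_H10Graph hb) hasWeakDeriv_expLp
  have h3 := congrArg (starRingEnd ℂ) h2
  simp only [WithLp.toLp_fst, WithLp.toLp_snd, inner_sub_left, inner_add_left, inner_smul_left,
    inner_neg_right, inner_expLp_self, map_neg, map_sub, map_add, map_mul, inner_conj_symm,
    starRingEnd_self_apply, map_div₀, map_one, map_ofNat] at h1 h3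
  rw [Complex.star_def]
  linear_combination h1 + (starRingEnd ℂ) a * h3

end HalfLine

/-- A Lax–Milgram theorem on a closed subspace. -/
theorem exists_forall_inner_eq_of_coercive {E : Type*} [NormedAddCommGroup E]
    [InnerProductSpace ℂ E] (K : Submodule ℂ E) [CompleteSpace K] (P : E →L[ℂ] E) {δ : ℝ}
    (hδ : 0 < δ) (hP : ∀ p ∈ K, δ * ‖p‖ ^ 2 ≤ (⟪P p, p⟫_ℂ).re) (F : StrongDual ℂ E) :
    ∃ u ∈ K, ∀ p ∈ K, ⟪P u, p⟫_ℂ = F p := by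
  -- The compression of `P` to `K` is bounded below by coercivity, hence invertible.
  let Q : K →L[ℂ] K := K.orthogonalProjectionOnto ∘L P ∘L K.subtypeL
  have hQ (u p : K) : ⟪Q u, p⟫_ℂ = ⟪P u, (p : E)⟫_ℂ :=
    Submodule.inner_orthogonalProjectionOnto_eq_of_mem_right p (P u)
  have hu : IsUnit Q := by
    refine Q.isUnit_of_forall_le_norm_inner_map (c := ⟨δ, hδ.le⟩) hδ fun x => ?_
    rw [hQ, mul_comm]
    exact (hP x x.2).trans (Complex.re_le_norm _)
  obtain ⟨R, hR⟩ := hu.exists_right_inv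
  let z : K := (InnerProductSpace.toDual ℂ K).symm (F ∘L K.subtypeL)
  refine ⟨R z, (R z).2, fun p hp => ?_⟩
  have h1 : Q (R z) = z := congrArg (fun T : K →L[ℂ] K => T z) hR
  rw [← hQ (R z) ⟨p, hp⟩, h1, InnerProductSpace.toDual_symm_apply]
  rfl

namespace HalfLine

/-! ## Calculus in `H¹(ℝ⁺)` -/

theorem hasWeakDeriv_weakDeriv {f : L2} (h : f ∈ H1) : HasWeakDeriv f (weakDeriv f) := by
  obtain ⟨g, hg⟩ := h
  rwa [hg.weakDeriv_eq]

theorem hasTrace_trace {f : L2} (h : f ∈ H1) : HasTrace f (trace f) := by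
  obtain ⟨c, hc, -⟩ := (hasWeakDeriv_weakDeriv h).exists_hasTrace
  rwa [hc.trace_eq]

theorem H2_le_H1 : H2 ≤ H1 := fun _ ⟨g, _, h, _⟩ => ⟨g, h⟩

theorem weakDeriv_mem_H1 {f : L2} (h : f ∈ H2) : weakDeriv f ∈ H1 := by
  obtain ⟨g, k, h1, h2⟩ := h
  rw [h1.weakDeriv_eq]
  exact ⟨k, h2⟩

theorem mem_H2_of_weakDeriv_mem_H1 {f : L2} (h : f ∈ H1) (h' : weakDeriv f ∈ H1) : f ∈ H2 :=
  ⟨_, _, hasWeakDeriv_weakDeriv h, hasWeakDeriv_weakDeriv h'⟩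

theorem weakDeriv_add {f g : L2} (hf : f ∈ H1) (hg : g ∈ H1) :
    weakDeriv (f + g) = weakDeriv f + weakDeriv g :=
  ((hasWeakDeriv_weakDeriv hf).add (hasWeakDeriv_weakDeriv hg)).weakDeriv_eq

theorem weakDeriv_smul {f : L2} (c : ℂ) (hf : f ∈ H1) :
    weakDeriv (c • f) = c • weakDeriv f :=
  ((hasWeakDeriv_weakDeriv hf).smul c).weakDeriv_eq

theorem weakDeriv_sub {f g : L2} (hf : f ∈ H1) (hg : g ∈ H1) :
    weakDeriv (f - g) = weakDeriv f - weakDeriv g := by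
  rw [sub_eq_add_neg, ← neg_one_smul ℂ g, weakDeriv_add hf (H1.smul_mem _ hg),
    weakDeriv_smul _ hg, neg_one_smul, ← sub_eq_add_neg]

theorem trace_add {f g : L2} (hf : f ∈ H1) (hg : g ∈ H1) : trace (f + g) = trace f + trace g :=
  ((hasTrace_trace hf).add (hasTrace_trace hg)).trace_eq

theorem trace_smul {f : L2} (c : ℂ) (hf : f ∈ H1) : trace (c • f) = c * trace f :=
  ((hasTrace_trace hf).smul c).trace_eq

theorem trace_sub {f g : L2} (hf : f ∈ H1) (hg : g ∈ H1) : trace (f - g) = trace f - trace g := by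
  rw [sub_eq_add_neg, ← neg_one_smul ℂ g, trace_add hf (H1.smul_mem _ hg),
    trace_smul _ hg, neg_one_mul, ← sub_eq_add_neg]

theorem inner_weakDeriv_add_inner {f h : L2} (hf : f ∈ H1) (hh : h ∈ H1) :
    ⟪f, weakDeriv h⟫_ℂ + ⟪weakDeriv f, h⟫_ℂ = -(star (trace f) * trace h) :=
  (hasWeakDeriv_weakDeriv hf).inner_add_inner (hasWeakDeriv_weakDeriv hh) (hasTrace_trace hf)
    (hasTrace_trace hh)

theorem pair_weakDeriv_mem {f : L2} (hf : f ∈ H1) (h0 : trace f = 0) :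
    pair f (weakDeriv f) ∈ H10Graph :=
  (hasWeakDeriv_weakDeriv hf).mem_H10Graph (h0 ▸ hasTrace_trace hf)

theorem mem_H1_of_mem_H10Graph {p : WithLp 2 (L2 × L2)} (hp : p ∈ H10Graph) : p.fst ∈ H1 :=
  ⟨_, hasWeakDeriv_of_mem_H10Graph hp⟩

theorem trace_of_mem_H10Graph {p : WithLp 2 (L2 × L2)} (hp : p ∈ H10Graph) : trace p.fst = 0 :=
  (hasTrace_zero_of_mem_H10Graph hp).trace_eq

theorem weakDeriv_of_mem_H10Graph {p : WithLp 2 (L2 × L2)} (hp : p ∈ H10Graph) :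
    weakDeriv p.fst = p.snd := (hasWeakDeriv_of_mem_H10Graph hp).weakDeriv_eq

theorem mem_H20_iff {f : L2} : f ∈ H20 ↔ f ∈ H2 ∧ trace f = 0 ∧ trace (weakDeriv f) = 0 := by
  refine ⟨fun ⟨h1, h2, h3⟩ => ⟨h1, h2.trace_eq, h3.trace_eq⟩, fun ⟨h1, h2, h3⟩ => ⟨h1, ?_, ?_⟩⟩
  · exact h2 ▸ hasTrace_trace (H2_le_H1 h1)
  · exact h3 ▸ hasTrace_trace (weakDeriv_mem_H1 h1)

theorem H20_le_H2 : H20 ≤ H2 := fun _ h => h.1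

theorem H20_le_H1 : H20 ≤ H1 := H20_le_H2.trans H2_le_H1

theorem weakDeriv_testLp {φ : ℝ → ℝ} (h : IsTest φ) :
    weakDeriv (testLp h) = testLp h.isTest_deriv := (hasWeakDeriv_testLp h).weakDeriv_eq

theorem testLp_mem_H20 {φ : ℝ → ℝ} (h : IsTest φ) : testLp h ∈ H20 := by
  refine ⟨⟨_, _, hasWeakDeriv_testLp h, hasWeakDeriv_testLp h.isTest_deriv⟩,
    hasTrace_zero_of_mem_H10Graph (pair_testLp_mem h), ?_⟩
  rw [weakDeriv_testLp]
  exact hasTrace_zero_of_mem_H10Graph (pair_testLp_mem h.isTest_deriv)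

theorem fst_mem_H20_of_mem_testGraph {p : WithLp 2 (L2 × L2)} (hp : p ∈ testGraph) :
    p.fst ∈ H20 := by
  induction hp using Submodule.span_induction with
  | mem p hp =>
    obtain ⟨φ, hφ, rfl⟩ := hp
    exact testLp_mem_H20 hφ
  | zero => exact H20.zero_mem
  | add p q _ _ hp hq => exact H20.add_mem hp hq
  | smul c p _ hp => exact H20.smul_mem c hp

/-- Density of `H²₀` in `H¹₀` for the `H¹` norm; it serves both the Friedrichs form domain and the
optimality of the completed square. -/
theorem exists_seq_H20_tendsto {f : L2} (hf : f ∈ H1) (h0 : trace f = 0) :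
    ∃ u : ℕ → L2, (∀ n, u n ∈ H20) ∧ Tendsto u atTop (𝓝 f) ∧
      Tendsto (fun n => weakDeriv (u n)) atTop (𝓝 (weakDeriv f)) := by
  obtain ⟨u, hu, hlim⟩ := mem_closure_iff_seq_limit.1 (pair_weakDeriv_mem hf h0)
  refine ⟨fun n => (u n).fst, fun n => fst_mem_H20_of_mem_testGraph (hu n), ?_, ?_⟩
  · exact ((WithLp.prod_continuous_ofLp 2 L2 L2).fst.tendsto _).comp hlim
  · have : (fun n => weakDeriv (u n).fst) = fun n => (u n).snd :=
      funext fun n => weakDeriv_of_mem_H10Graph (testGraph.le_topologicalClosure (hu n))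
    rw [this]
    exact ((WithLp.prod_continuous_ofLp 2 L2 L2).snd.tendsto _).comp hlim

theorem dense_H20 : Dense (H20 : Set L2) := by
  rw [Submodule.dense_iff_topologicalClosure_eq_top,
    Submodule.topologicalClosure_eq_top_iff, Submodule.eq_bot_iff]
  exact fun f hf => eq_zero_of_inner_testLp fun φ h =>
    (Submodule.mem_orthogonal _ _).1 hf _ (testLp_mem_H20 h)

/-! ## The potential and the energy form -/

variable (V : LInf)

/-- Multiplication by `V`. -/
noncomputable def mulV : L2 →L[ℂ] L2 :=
  LinearMap.mkContinuous
    { toFun := fun f => V • f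
      map_add' := fun f g => Lp.add_smul V f g
      map_smul' := fun c f => potential_smul_comm V c f } ‖V‖ (Lp.norm_smul_le V)

theorem mulV_apply (f : L2) : mulV V f = V • f := rfl

theorem inner_mulV_right (f g : L2) : ⟪f, mulV V g⟫_ℂ = ∫ x in Ioi (0 : ℝ), V x * ⟪f x, g x⟫_ℂ := by
  rw [L2.inner_def]
  refine integral_congr_ae ?_
  filter_upwards [Lp.coeFn_lpSMul (r := 2) V g] with x hx
  rw [mulV_apply, hx, Pi.smul_apply', inner_smul_right_eq_smul, Complex.real_smul]

theorem inner_mulV_symm (f g : L2) : ⟪mulV V f, g⟫_ℂ = ⟪f, mulV V g⟫_ℂ := by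
  rw [← inner_conj_symm, inner_mulV_right, inner_mulV_right, ← integral_conj]
  refine integral_congr_ae (Eventually.of_forall fun x => ?_)
  simp only [map_mul, Complex.conj_ofReal, inner_conj_symm]

theorem inner_mulV_self (f : L2) :
    ⟪f, mulV V f⟫_ℂ = ((∫ x in Ioi (0 : ℝ), ‖f x‖ ^ 2 * V x : ℝ) : ℂ) := by
  rw [inner_mulV_right, ← integral_complex_ofReal]
  refine integral_congr_ae (Eventually.of_forall fun x => ?_)
  simp only [inner_self_eq_norm_sq_to_K]
  push_cast
  exact mul_comm _ _

theorem le_re_inner_mulV_self {ε : ℝ} (hV : ∀ᵐ x ∂vol, ε ≤ V x) (f : L2) :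
    ε * ‖f‖ ^ 2 ≤ (⟪f, mulV V f⟫_ℂ).re := by
  have hsq : Integrable (fun x => ‖f x‖ ^ 2) vol :=
    (memLp_two_iff_integrable_sq_norm (Lp.aestronglyMeasurable f)).1 (Lp.memLp f)
  have hnorm : ‖f‖ ^ 2 = ∫ x in Ioi (0 : ℝ), ‖f x‖ ^ 2 := by
    have h : ((‖f‖ ^ 2 : ℝ) : ℂ) = ((∫ x in Ioi (0 : ℝ), ‖f x‖ ^ 2 : ℝ) : ℂ) := by
      rw [← integral_complex_ofReal, Complex.ofReal_pow]
      refine (inner_self_eq_norm_sq_to_K (𝕜 := ℂ) f).symm.trans ?_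
      rw [L2.inner_def]
      refine integral_congr_ae (Eventually.of_forall fun x => ?_)
      simp only [inner_self_eq_norm_sq_to_K, Complex.ofReal_pow]
      rfl
    exact_mod_cast h
  have hi : Integrable (fun x => ‖f x‖ ^ 2 * V x) vol := by
    have := L2.integrable_inner (𝕜 := ℂ) f (mulV V f)
    refine this.re.congr ?_
    filter_upwards [Lp.coeFn_lpSMul (r := 2) V f] with x hx
    rw [mulV_apply, hx, Pi.smul_apply', inner_smul_right_eq_smul, Complex.real_smul,
      inner_self_eq_norm_sq_to_K]
    norm_cast
    change ((V x : ℂ) * ((‖f x‖ ^ 2 : ℝ) : ℂ)).re = _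
    rw [Complex.re_ofReal_mul, Complex.ofReal_re, mul_comm]
  rw [inner_mulV_self, Complex.ofReal_re, hnorm, ← integral_const_mul]
  refine integral_mono_ae (hsq.const_mul ε) hi ?_
  filter_upwards [hV] with x hx
  rw [mul_comm]
  exact mul_le_mul_of_nonneg_left hx (sq_nonneg _)

/-- The sesquilinear form `(f, h) ↦ ⟨f', h'⟩ + ⟨f, V h⟩`. -/
noncomputable def energy (f h : L2) : ℂ := ⟪weakDeriv f, weakDeriv h⟫_ℂ + ⟪f, mulV V h⟫_ℂ

theorem star_energy (f h : L2) : star (energy V f h) = energy V h f := by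
  simp only [energy, star_add, Complex.star_def, inner_conj_symm, inner_mulV_symm]

theorem energy_add_left {f g h : L2} (hf : f ∈ H1) (hg : g ∈ H1) :
    energy V (f + g) h = energy V f h + energy V g h := by
  simp only [energy, weakDeriv_add hf hg, inner_add_left]
  ring

theorem energy_sub_left {f g h : L2} (hf : f ∈ H1) (hg : g ∈ H1) :
    energy V (f - g) h = energy V f h - energy V g h := by
  simp only [energy, weakDeriv_sub hf hg, inner_sub_left]
  ring

theorem energy_smul_left {f h : L2} (c : ℂ) (hf : f ∈ H1) :
    energy V (c • f) h = star c * energy V f h := by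
  simp only [energy, weakDeriv_smul c hf, inner_smul_left, Complex.star_def]
  ring

theorem energy_add_right {f g h : L2} (hg : g ∈ H1) (hh : h ∈ H1) :
    energy V f (g + h) = energy V f g + energy V f h := by
  simp only [energy, weakDeriv_add hg hh, inner_add_right, map_add]
  ring

theorem energy_sub_right {f g h : L2} (hg : g ∈ H1) (hh : h ∈ H1) :
    energy V f (g - h) = energy V f g - energy V f h := by
  simp only [energy, weakDeriv_sub hg hh, inner_sub_right, map_sub]
  ring

theorem energy_smul_right {f h : L2} (c : ℂ) (hh : h ∈ H1) :
    energy V f (c • h) = c * energy V f h := by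
  simp only [energy, weakDeriv_smul c hh, inner_smul_right, map_smul]
  ring

theorem energy_self_eq (f : L2) : energy V f f =
    ((‖weakDeriv f‖ ^ 2 + ∫ x in Ioi (0 : ℝ), ‖f x‖ ^ 2 * V x : ℝ) : ℂ) := by
  rw [energy, inner_mulV_self, inner_self_eq_norm_sq_to_K]
  push_cast
  rfl

variable {V}

theorem le_re_energy_self {ε : ℝ} (hV : ∀ᵐ x ∂vol, ε ≤ V x) (f : L2) :
    ‖weakDeriv f‖ ^ 2 + ε * ‖f‖ ^ 2 ≤ (energy V f f).re := by
  rw [energy, Complex.add_re]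
  refine add_le_add (le_of_eq ?_) (le_re_inner_mulV_self V hV f)
  rw [inner_self_eq_norm_sq_to_K]
  norm_cast

theorem re_energy_self_nonneg {ε : ℝ} (hε : 0 < ε) (hV : ∀ᵐ x ∂vol, ε ≤ V x) (f : L2) :
    0 ≤ (energy V f f).re :=
  le_trans (by positivity) (le_re_energy_self hV f)

theorem eq_zero_of_energy_self {ε : ℝ} (hε : 0 < ε) (hV : ∀ᵐ x ∂vol, ε ≤ V x) {f : L2}
    (h : (energy V f f).re ≤ 0) : f = 0 := by
  have h1 := le_re_energy_self hV f
  have h2 : ε * ‖f‖ ^ 2 ≤ 0 := by nlinarith [sq_nonneg ‖weakDeriv f‖]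
  have h3 : ‖f‖ ^ 2 ≤ 0 := by
    by_contra hn
    exact absurd h2 (not_le.2 (mul_pos hε (not_le.1 hn)))
  exact norm_eq_zero.1 (pow_eq_zero_iff (two_ne_zero) |>.1 (le_antisymm h3 (sq_nonneg _)))

/-- Green's formula. -/
theorem inner_schrodinger {f h : L2} (hf : f ∈ H1) (hh : h ∈ H2) :
    ⟪f, schrodinger V h⟫_ℂ = energy V f h + star (trace f) * trace (weakDeriv h) := by
  have := inner_weakDeriv_add_inner hf (weakDeriv_mem_H1 hh)
  rw [schrodinger, energy, inner_add_right, inner_neg_right, mulV_apply]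
  linear_combination -this

theorem schrodinger_inner {f h : L2} (hf : f ∈ H1) (hh : h ∈ H2) :
    ⟪schrodinger V h, f⟫_ℂ = energy V h f + trace f * star (trace (weakDeriv h)) := by
  rw [← inner_conj_symm, inner_schrodinger hf hh, map_add, map_mul, ← Complex.star_def,
    star_energy, star_star]

theorem inner_schrodinger_H20 {f h : L2} (hf : f ∈ H1) (hh : h ∈ H20) :
    ⟪f, schrodinger V h⟫_ℂ = energy V f h := by
  obtain ⟨h1, -, h3⟩ := mem_H20_iff.1 hh
  rw [inner_schrodinger hf h1, h3, mul_zero, add_zero]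

theorem schrodinger_symm_H20 {f h : L2} (hf : f ∈ H2) (hh : h ∈ H20) :
    ⟪schrodinger V f, h⟫_ℂ = ⟪f, schrodinger V h⟫_ℂ := by
  rw [inner_schrodinger_H20 (H2_le_H1 hf) hh, schrodinger_inner (H20_le_H1 hh) hf,
    (mem_H20_iff.1 hh).2.1, zero_mul, add_zero]

/-! ### Variational solution of the Dirichlet problem `-u'' + V u + c u = w`. -/

theorem exists_energy_eq {ε : ℝ} (hε : 0 < ε) (hV : ∀ᵐ x ∂vol, ε ≤ V x) {c : ℝ} (hc : 0 ≤ c)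
    (F : StrongDual ℂ (WithLp 2 (L2 × L2))) :
    ∃ u ∈ H1, trace u = 0 ∧ ∀ f ∈ H1, trace f = 0 →
      energy V u f + c * ⟪u, f⟫_ℂ = F (pair f (weakDeriv f)) := by
  -- `P (f, g) = (V f + c f, g)`, so that on pairs `(f, f')` its form is the energy form plus `c ⟨·,
  -- ·⟩`; it is coercive with constant `min ε 1`.
  let P : WithLp 2 (L2 × L2) →L[ℂ] WithLp 2 (L2 × L2) :=
    (WithLp.prodContinuousLinearEquiv 2 ℂ L2 L2).symm.toContinuousLinearMap ∘L
      ((mulV V + (c : ℂ) • ContinuousLinearMap.id ℂ L2).prodMap (ContinuousLinearMap.id ℂ L2)) ∘L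
        (WithLp.prodContinuousLinearEquiv 2 ℂ L2 L2).toContinuousLinearMap
  have hP (p q : WithLp 2 (L2 × L2)) : ⟪P p, q⟫_ℂ =
      ⟪p.snd, q.snd⟫_ℂ + ⟪p.fst, mulV V q.fst⟫_ℂ + c * ⟪p.fst, q.fst⟫_ℂ := by
    rw [WithLp.prod_inner_apply]
    change ⟪mulV V p.fst + (c : ℂ) • p.fst, q.fst⟫_ℂ + ⟪p.snd, q.snd⟫_ℂ = _
    rw [inner_add_left, inner_smul_left, inner_mulV_symm, Complex.conj_ofReal]
    ring
  have hco : ∀ p ∈ H10Graph, min ε 1 * ‖p‖ ^ 2 ≤ (⟪P p, p⟫_ℂ).re := by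
    intro p _
    have h1 := le_re_inner_mulV_self V hV p.fst
    rw [hP, WithLp.prod_norm_sq_eq_of_L2, inner_self_eq_norm_sq_to_K, inner_self_eq_norm_sq_to_K]
    have e : ((‖p.snd‖ : ℂ) ^ 2 + ⟪p.fst, mulV V p.fst⟫_ℂ + (c : ℂ) * (‖p.fst‖ : ℂ) ^ 2).re =
        ‖p.snd‖ ^ 2 + (⟪p.fst, mulV V p.fst⟫_ℂ).re + c * ‖p.fst‖ ^ 2 := by
      rw [← Complex.ofReal_pow, ← Complex.ofReal_pow, ← Complex.ofReal_mul, Complex.add_re,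
        Complex.add_re, Complex.ofReal_re, Complex.ofReal_re]
    refine le_of_le_of_eq ?_ e.symm
    nlinarith [min_le_left ε 1, min_le_right ε 1, sq_nonneg ‖p.fst‖, sq_nonneg ‖p.snd‖,
      mul_nonneg hc (sq_nonneg ‖p.fst‖),
      mul_le_mul_of_nonneg_right (min_le_left ε 1) (sq_nonneg ‖p.fst‖),
      mul_le_mul_of_nonneg_right (min_le_right ε 1) (sq_nonneg ‖p.snd‖)]
  obtain ⟨u, hu, H⟩ := exists_forall_inner_eq_of_coercive H10Graph P (lt_min hε one_pos) hco F
  refine ⟨u.fst, mem_H1_of_mem_H10Graph hu, trace_of_mem_H10Graph hu, fun f hf h0 => ?_⟩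
  rw [← H _ (pair_weakDeriv_mem hf h0), hP, energy, weakDeriv_of_mem_H10Graph hu]
  rfl

/-- Regularity of weak solutions: tested against `φ`, the energy identity is literally the weak form
of `u'' = V u - w`. -/
theorem hasWeakDeriv_weakDeriv_of_energy_eq {u w : L2}
    (H : ∀ (φ : ℝ → ℝ) (h : IsTest φ), energy V u (testLp h) = ⟪w, testLp h⟫_ℂ) :
    HasWeakDeriv (weakDeriv u) (V • u - w) := by
  refine hasWeakDeriv_iff.2 fun φ h => ?_
  have := congrArg star (H φ h)
  rw [star_energy, energy, weakDeriv_testLp, Complex.star_def, inner_conj_symm] at this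
  rw [inner_sub_right, ← mulV_apply]
  linear_combination this

theorem schrodinger_eq_of_energy_eq {u w : L2} (hu : u ∈ H1)
    (H : ∀ (φ : ℝ → ℝ) (h : IsTest φ), energy V u (testLp h) = ⟪w, testLp h⟫_ℂ) :
    u ∈ H2 ∧ schrodinger V u = w := by
  have h := hasWeakDeriv_weakDeriv_of_energy_eq H
  refine ⟨mem_H2_of_weakDeriv_mem_H1 hu ⟨_, h⟩, ?_⟩
  rw [schrodinger, h.weakDeriv_eq]
  abel

/-- Surjectivity of `S_F + c`. The case `c = 0` inverts `S_F`; the case `c = 1` is used for the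
range condition behind maximality. -/
theorem exists_schrodinger_add_smul_eq {ε : ℝ} (hε : 0 < ε) (hV : ∀ᵐ x ∂vol, ε ≤ V x) {c : ℝ}
    (hc : 0 ≤ c) (w : L2) :
    ∃ u ∈ H2, trace u = 0 ∧ schrodinger V u + (c : ℂ) • u = w := by
  obtain ⟨u, hu, h0, H⟩ := exists_energy_eq hε hV hc
    (innerSL ℂ w ∘L (ContinuousLinearMap.fst ℂ L2 L2) ∘L
      (WithLp.prodContinuousLinearEquiv 2 ℂ L2 L2).toContinuousLinearMap)
  obtain ⟨h1, h2⟩ := schrodinger_eq_of_energy_eq (V := V) (w := w - (c : ℂ) • u) hu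
    fun φ h => by
      have := H _ (H20_le_H1 (testLp_mem_H20 h)) (mem_H20_iff.1 (testLp_mem_H20 h)).2.1
      rw [inner_sub_left, inner_smul_left, Complex.conj_ofReal]
      exact eq_sub_of_add_eq this
  exact ⟨u, h1, h0, by rw [h2, sub_add_cancel]⟩

theorem S_apply (f : (S V).domain) : S V f = schrodinger V f := rfl

/-! ## The Friedrichs extension -/

theorem mem_friedrichsFormDomain {l : L2} (hl : l ∈ H1) (h0 : trace l = 0) :
    l ∈ friedrichsFormDomain (S V) := by
  obtain ⟨u, hu, h1, h2⟩ := exists_seq_H20_tendsto hl h0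
  refine ⟨fun n => ⟨u n, hu n⟩, h1, ?_⟩
  have e (p : ℕ × ℕ) : ⟪(((⟨u p.1, hu p.1⟩ : (S V).domain) - ⟨u p.2, hu p.2⟩ : (S V).domain) : L2),
      S V (⟨u p.1, hu p.1⟩ - ⟨u p.2, hu p.2⟩)⟫_ℂ =
      ⟪weakDeriv (u p.1) - weakDeriv (u p.2), weakDeriv (u p.1) - weakDeriv (u p.2)⟫_ℂ +
        ⟪u p.1 - u p.2, mulV V (u p.1 - u p.2)⟫_ℂ := by
    have hm : u p.1 - u p.2 ∈ H20 := H20.sub_mem (hu _) (hu _)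
    change ⟪u p.1 - u p.2, schrodinger V (u p.1 - u p.2)⟫_ℂ = _
    rw [inner_schrodinger_H20 (H20_le_H1 hm) hm, energy,
      weakDeriv_sub (H20_le_H1 (hu _)) (H20_le_H1 (hu _))]
  simp only [e]
  have t1 : Tendsto (fun p : ℕ × ℕ => u p.1 - u p.2) atTop (𝓝 0) := by
    rw [← prod_atTop_atTop_eq, ← sub_self l]
    exact (h1.comp tendsto_fst).sub (h1.comp tendsto_snd)
  have t2 : Tendsto (fun p : ℕ × ℕ => weakDeriv (u p.1) - weakDeriv (u p.2)) atTop (𝓝 0) := by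
    rw [← prod_atTop_atTop_eq, ← sub_self (weakDeriv l)]
    exact (h2.comp tendsto_fst).sub (h2.comp tendsto_snd)
  have t3 := ((mulV V).continuous.tendsto 0).comp t1
  have := (t2.inner t2 (𝕜 := ℂ)).add (t1.inner t3 (𝕜 := ℂ))
  simpa using this

/-- The energy dominates `‖f'‖²`, so the derivatives of a form-Cauchy sequence converge, and the
graph of `H¹₀` is closed. -/
theorem mem_H1_of_mem_friedrichsFormDomain {ε : ℝ} (hε : 0 < ε) (hV : ∀ᵐ x ∂vol, ε ≤ V x) {l : L2}
    (hl : l ∈ friedrichsFormDomain (S V)) : l ∈ H1 ∧ trace l = 0 := by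
  obtain ⟨u, hu, hlim⟩ := hl
  have hc : CauchySeq fun n => weakDeriv (u n : L2) := by
    rw [cauchySeq_iff_tendsto_dist_atTop_0]
    have hre := (Complex.continuous_re.tendsto _).comp hlim
    have hs := (Real.continuous_sqrt.tendsto _).comp hre
    rw [Complex.zero_re, Real.sqrt_zero] at hs
    refine squeeze_zero (fun _ => dist_nonneg) (fun p => ?_) hs
    have hm : (u p.1 : L2) - u p.2 ∈ H20 := H20.sub_mem (u p.1).2 (u p.2).2
    refine Real.le_sqrt_of_sq_le ?_
    change _ ≤ (⟪(u p.1 : L2) - u p.2, schrodinger V ((u p.1 : L2) - u p.2)⟫_ℂ).re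
    rw [inner_schrodinger_H20 (H20_le_H1 hm) hm, dist_eq_norm,
      ← weakDeriv_sub (H20_le_H1 (u p.1).2) (H20_le_H1 (u p.2).2)]
    refine le_trans ?_ (le_re_energy_self hV _)
    exact le_add_of_nonneg_right (by positivity)
  obtain ⟨g, hg⟩ := cauchySeq_tendsto_of_complete hc
  have hmem : pair l g ∈ H10Graph := by
    refine testGraph.isClosed_topologicalClosure.mem_of_tendsto (f := fun n =>
      pair (u n) (weakDeriv (u n : L2))) (b := atTop) ?_ (Eventually.of_forall fun n =>
        pair_weakDeriv_mem (H20_le_H1 (u n).2) (mem_H20_iff.1 (u n).2).2.1)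
    exact ((WithLp.prod_continuous_toLp 2 L2 L2).tendsto (l, g)).comp (hu.prodMk_nhds hg)
  exact ⟨mem_H1_of_mem_H10Graph hmem, trace_of_mem_H10Graph hmem⟩

theorem friedrichsGraph_S_iff {ε : ℝ} (hε : 0 < ε) (hV : ∀ᵐ x ∂vol, ε ≤ V x) (l w : L2) :
    FriedrichsGraph (S V) l w ↔ l ∈ H2 ∧ HasTrace l 0 ∧ w = schrodinger V l := by
  constructor
  · rintro ⟨hl, H⟩
    obtain ⟨h1, h0⟩ := mem_H1_of_mem_friedrichsFormDomain hε hV hl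
    obtain ⟨h2, h3⟩ := schrodinger_eq_of_energy_eq (V := V) (w := w) h1 fun φ h => by
      rw [H ⟨testLp h, testLp_mem_H20 h⟩, S_apply, inner_schrodinger_H20 h1 (testLp_mem_H20 h)]
    exact ⟨h2, h0 ▸ hasTrace_trace h1, h3.symm⟩
  · rintro ⟨h2, h0, rfl⟩
    exact ⟨mem_friedrichsFormDomain (H2_le_H1 h2) h0.trace_eq,
      fun f => schrodinger_symm_H20 h2 f.2⟩

/-! ## The function `η` -/

theorem isEta_iff {η : L2} : IsEta V η ↔ η ∈ H2 ∧ schrodinger V η = 0 ∧ trace η = 1 := by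
  refine and_congr_right fun h => and_congr ?_ ⟨HasTrace.trace_eq, fun h1 => ?_⟩
  · rw [schrodinger, neg_add_eq_zero]
  · exact h1 ▸ hasTrace_trace (H2_le_H1 h)

theorem eq_zero_of_schrodinger_eq_zero {ε : ℝ} (hε : 0 < ε) (hV : ∀ᵐ x ∂vol, ε ≤ V x) {f : L2}
    (hf : f ∈ H2) (h0 : trace f = 0) (h : schrodinger V f = 0) : f = 0 := by
  refine eq_zero_of_energy_self hε hV (le_of_eq ?_)
  have := inner_schrodinger (V := V) (H2_le_H1 hf) hf
  rw [h, h0, inner_zero_right, star_zero, zero_mul, add_zero] at this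
  rw [← this, Complex.zero_re]

theorem schrodinger_sub {f g : L2} (hf : f ∈ H2) (hg : g ∈ H2) :
    schrodinger V (f - g) = schrodinger V f - schrodinger V g := by
  rw [sub_eq_add_neg, ← neg_one_smul ℂ g, schrodinger_add V hf (H2.smul_mem _ hg),
    schrodinger_smul V _ hg, neg_one_smul, ← sub_eq_add_neg]

theorem schrodinger_neg {f : L2} (hf : f ∈ H2) : schrodinger V (-f) = -schrodinger V f := by
  rw [← neg_one_smul ℂ f, schrodinger_smul V _ hf, neg_one_smul]

theorem expLp_mem_H2 : expLp ∈ H2 :=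
  ⟨_, _, hasWeakDeriv_expLp, by simpa using hasWeakDeriv_expLp.smul (-1)⟩

theorem existsUnique_isEta {ε : ℝ} (hε : 0 < ε) (hV : ∀ᵐ x ∂vol, ε ≤ V x) :
    ∃! η, IsEta V η := by
  simp only [isEta_iff]
  -- `exp (-x)` has the right boundary value; subtracting a Dirichlet solution removes its defect in
  -- the equation.
  obtain ⟨u, hu, h0, h⟩ := exists_schrodinger_add_smul_eq hε hV le_rfl (schrodinger V expLp)
  rw [Complex.ofReal_zero, zero_smul, add_zero] at h
  refine ⟨expLp - u, ⟨H2.sub_mem expLp_mem_H2 hu, ?_, ?_⟩, ?_⟩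
  · rw [schrodinger_sub expLp_mem_H2 hu, h, sub_self]
  · rw [trace_sub (H2_le_H1 expLp_mem_H2) (H2_le_H1 hu), h0, hasTrace_expLp.trace_eq, sub_zero]
  · rintro η ⟨h1, h2, h3⟩
    have hm := H2.sub_mem h1 (H2.sub_mem expLp_mem_H2 hu)
    refine sub_eq_zero.1 (eq_zero_of_schrodinger_eq_zero hε hV hm ?_ ?_)
    · rw [trace_sub (H2_le_H1 h1) (H2_le_H1 (H2.sub_mem expLp_mem_H2 hu)), h3,
        trace_sub (H2_le_H1 expLp_mem_H2) (H2_le_H1 hu), h0, hasTrace_expLp.trace_eq, sub_zero,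
        sub_self]
    · rw [schrodinger_sub h1 (H2.sub_mem expLp_mem_H2 hu), schrodinger_sub expLp_mem_H2 hu, h, h2,
        sub_self, sub_self]

theorem energy_eta_left {η : L2} (hη : IsEta V η)
    {f : L2} (hf : f ∈ H1) :
    energy V η f = -(trace f * star (trace (weakDeriv η))) := by
  obtain ⟨h1, h2, -⟩ := isEta_iff.1 hη
  have := schrodinger_inner (V := V) hf h1
  rw [h2, inner_zero_left] at this
  linear_combination -this

theorem trace_weakDeriv_eta_im {η : L2} (hη : IsEta V η) : (trace (weakDeriv η)).im = 0 := by
  obtain ⟨h1, -, h3⟩ := isEta_iff.1 hη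
  have h := energy_eta_left hη (H2_le_H1 h1)
  rw [energy_self_eq, h3, one_mul] at h
  have := congrArg Complex.im h
  rw [Complex.ofReal_im, Complex.neg_im, Complex.star_def, Complex.conj_im, neg_neg] at this
  exact this.symm

theorem star_trace_weakDeriv_eta {η : L2} (hη : IsEta V η) :
    star (trace (weakDeriv η)) = ((trace (weakDeriv η)).re : ℂ) := by
  refine Complex.ext rfl ?_
  simp [trace_weakDeriv_eta_im hη]

theorem inner_eta_schrodinger {η : L2} (hη : IsEta V η)
    {f : L2} (hf : f ∈ H2) (h0 : trace f = 0) :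
    ⟪η, schrodinger V f⟫_ℂ = trace (weakDeriv f) := by
  obtain ⟨h1, -, h3⟩ := isEta_iff.1 hη
  rw [inner_schrodinger (H2_le_H1 h1) hf, energy_eta_left hη (H2_le_H1 hf), h0, h3]
  simp

theorem eta_ne_zero {η : L2} (hη : IsEta V η) : η ≠ 0 := by
  rintro rfl
  have := (isEta_iff.1 hη).2.2
  rw [HasTrace.zero.trace_eq] at this
  exact zero_ne_one this

/-- The orthogonal complement of the range of `S` is spanned by `η`. -/
theorem eq_smul_eta_of_orthogonal {η : L2} (hη : IsEta V η)
    {ε : ℝ} (hε : 0 < ε) (hV : ∀ᵐ x ∂vol, ε ≤ V x) {z : L2}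
    (hz : ∀ f ∈ H20, ⟪z, schrodinger V f⟫_ℂ = 0) : ∃ c : ℂ, z = c • η := by
  obtain ⟨h1, h2, -⟩ := isEta_iff.1 hη
  have hne : ⟪η, η⟫_ℂ ≠ 0 := inner_self_ne_zero.2 (eta_ne_zero hη)
  set c : ℂ := ⟪η, z⟫_ℂ / ⟪η, η⟫_ℂ
  -- `c • η` is the projection of `z` on `η`. Writing `z - c • η = S_F u` gives `u'(0) = ⟨η, S_F u⟩
  -- = 0`, so `u ∈ H²₀`; hence `z - c • η` lies in the range of `S`, to which both `z` and `η` are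
  -- orthogonal, and it vanishes.
  obtain ⟨u, hu, h0, h⟩ := exists_schrodinger_add_smul_eq hε hV le_rfl (z - c • η)
  rw [Complex.ofReal_zero, zero_smul, add_zero] at h
  have hη0 : ⟪η, z - c • η⟫_ℂ = 0 := by
    rw [inner_sub_right, inner_smul_right, div_mul_cancel₀ _ hne, sub_self]
  have hu20 : u ∈ H20 := by
    refine mem_H20_iff.2 ⟨hu, h0, ?_⟩
    rw [← inner_eta_schrodinger hη hu h0, h, hη0]
  refine ⟨c, sub_eq_zero.1 (inner_self_eq_zero (𝕜 := ℂ).1 ?_)⟩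
  nth_rewrite 2 [← h]
  rw [inner_sub_left, hz u hu20, inner_smul_left, ← schrodinger_symm_H20 h1 hu20, h2,
    inner_zero_left, mul_zero, sub_zero]

/-! ## Dissipativity of `A_{v,ℓ}` -/

theorem mem_Aop_domain {v l : L2} {hv : v ∉ H20} {x : L2} :
    x ∈ (Aop V v l hv).domain ↔ ∃ f ∈ H20, ∃ c : ℂ, x = f + c • v := by
  change x ∈ H20 ⊔ ℂ ∙ v ↔ _
  simp only [Submodule.mem_sup, Submodule.mem_span_singleton]
  constructor
  · rintro ⟨f, hf, _, ⟨c, rfl⟩, rfl⟩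
    exact ⟨f, hf, c, rfl⟩
  · rintro ⟨f, hf, c, rfl⟩
    exact ⟨f, hf, _, ⟨c, rfl⟩, rfl⟩

theorem Aop_apply {v l : L2} {hv : v ∉ H20} {f : L2} (hf : f ∈ H20) (c : ℂ)
    (x : (Aop V v l hv).domain) (hx : (x : L2) = f + c • v) :
    Aop V v l hv x = Complex.I • (schrodinger V f + c • schrodinger V l) := by
  have h := LinearPMap.supSpanSingleton_apply_mk (Complex.I • S V) v
    (Complex.I • schrodinger V l) hv f hf c
  have hx' : x = ⟨f + c • v, hx ▸ x.2⟩ := Subtype.ext hx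
  rw [hx', smul_add, smul_comm Complex.I c]
  exact h

theorem im_inner_I_smul (x y : L2) : (⟪x, Complex.I • y⟫_ℂ).im = (⟪x, y⟫_ℂ).re := by
  rw [inner_smul_right, Complex.I_mul_im]

theorem dense_Aop_domain {v l : L2} {hv : v ∉ H20} :
    Dense ((Aop V v l hv).domain : Set L2) :=
  dense_H20.mono fun f hf => mem_Aop_domain.2 ⟨f, hf, 0, by simp⟩

/-- Vectors of `H²₀` cause no obstruction because `S ≥ 0`; every other domain vector is a multiple
of some `v - g`, and `key` expands the form there. The cross terms merge into `v + l` because `⟨g,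
S_F l⟩` and `⟨l, S g⟩` have the same real part. -/
theorem isDissipative_Aop_iff {ε : ℝ} (hε : 0 < ε) (hV : ∀ᵐ x ∂vol, ε ≤ V x) {v l : L2}
    (hv : v ∉ H20) (hl : l ∈ H2) :
    IsDissipative (Aop V v l hv) ↔ ∀ g ∈ H20,
      (⟪v + l, schrodinger V g⟫_ℂ).re ≤ (energy V g g).re + (⟪v, schrodinger V l⟫_ℂ).re := by
  have key (g : L2) (hg : g ∈ H20) : (⟪v - g, schrodinger V l - schrodinger V g⟫_ℂ).re =
      (energy V g g).re + (⟪v, schrodinger V l⟫_ℂ).re - (⟪v + l, schrodinger V g⟫_ℂ).re := by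
    have h1 : (⟪g, schrodinger V l⟫_ℂ).re = (⟪l, schrodinger V g⟫_ℂ).re := by
      rw [← schrodinger_symm_H20 hl hg, ← inner_conj_symm, Complex.conj_re]
    rw [inner_sub_right, inner_sub_left, inner_sub_left, inner_add_left,
      inner_schrodinger_H20 (H20_le_H1 hg) hg]
    simp only [Complex.sub_re, Complex.add_re, h1]
    ring
  constructor
  · rintro ⟨-, h⟩ g hg
    have hm : v - g = -g + (1 : ℂ) • v := by rw [one_smul]; abel
    have := h ⟨v - g, mem_Aop_domain.2 ⟨-g, H20.neg_mem hg, 1, hm⟩⟩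
    rw [Aop_apply (H20.neg_mem hg) 1 _ hm, im_inner_I_smul, one_smul,
      schrodinger_neg (H20_le_H2 hg), neg_add_eq_sub, key g hg] at this
    linarith
  · refine fun h => ⟨dense_Aop_domain, fun x => ?_⟩
    obtain ⟨f, hf, c, hx⟩ := mem_Aop_domain.1 x.2
    rw [Aop_apply hf c x hx, im_inner_I_smul, hx]
    rcases eq_or_ne c 0 with rfl | hc
    · rw [zero_smul, zero_smul, add_zero, add_zero, inner_schrodinger_H20 (H20_le_H1 hf) hf]
      exact re_energy_self_nonneg hε hV f
    · have hg : (-c⁻¹) • f ∈ H20 := H20.smul_mem _ hf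
      have e1 : f + c • v = c • (v - (-c⁻¹) • f) := by
        rw [smul_sub, smul_smul, mul_neg, mul_inv_cancel₀ hc, neg_one_smul, sub_neg_eq_add,
          add_comm]
      have e2 : schrodinger V f + c • schrodinger V l =
          c • (schrodinger V l - schrodinger V ((-c⁻¹) • f)) := by
        rw [schrodinger_smul V _ (H20_le_H2 hf), smul_sub, smul_smul, mul_neg,
          mul_inv_cancel₀ hc, neg_one_smul, sub_neg_eq_add, add_comm]
      rw [e1, e2, inner_smul_left, inner_smul_right, ← mul_assoc, Complex.conj_mul',
        ← Complex.ofReal_pow, Complex.re_ofReal_mul, key _ hg]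
      exact mul_nonneg (sq_nonneg _) (sub_nonneg.2 (h _ hg))

/-- The pairs `(f, f')` with `f ∈ H²₀(ℝ⁺)`. -/
noncomputable def H20Graph : Submodule ℂ (WithLp 2 (L2 × L2)) where
  carrier := {p | p.fst ∈ H20 ∧ HasWeakDeriv p.fst p.snd}
  zero_mem' := ⟨H20.zero_mem, .zero⟩
  add_mem' := fun h₁ h₂ => ⟨H20.add_mem h₁.1 h₂.1, h₁.2.add h₂.2⟩
  smul_mem' := fun c _ h => ⟨H20.smul_mem c h.1, h.2.smul c⟩

/-- Multiplying a unit vector by a phase makes `f x` equal to its absolute value. -/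
theorem norm_le_of_re_le {E : Type*} [NormedAddCommGroup E] [NormedSpace ℂ E] (f : E →ₗ[ℂ] ℂ)
    {c : ℝ} (h : ∀ x, ‖x‖ = 1 → (f x).re ≤ c) (x : E) : ‖f x‖ ≤ c * ‖x‖ := by
  have := LinearMap.bound_of_sphere_bound one_pos c f (fun z hz => ?_) x
  · rwa [div_one] at this
  · rw [mem_sphere_zero_iff_norm] at hz
    rcases eq_or_ne (f z) 0 with h0 | h0
    · have := h z hz
      rwa [h0, Complex.zero_re, ← norm_zero (E := ℂ), ← h0] at this
    · have hn : (‖f z‖ : ℂ) ≠ 0 := by exact_mod_cast norm_ne_zero_iff.2 h0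
      have e : f ((star (f z) / ‖f z‖) • z) = ‖f z‖ := by
        rw [map_smul, smul_eq_mul, div_mul_eq_mul_div, Complex.star_def, Complex.conj_mul', sq,
          mul_div_cancel_right₀ _ hn]
      have hz' : ‖(star (f z) / ‖f z‖) • z‖ = 1 := by
        rw [norm_smul, hz, mul_one, norm_div, norm_star, Complex.norm_real, norm_norm,
          div_self (norm_ne_zero_iff.2 h0)]
      have := h _ hz'
      rwa [e, Complex.ofReal_re] at this

theorem mem_H1_of_forall_le {ε : ℝ} (hε : 0 < ε) (hV : ∀ᵐ x ∂vol, ε ≤ V x) {η u : L2}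
    (hη : IsEta V η) {M : ℝ}
    (h : ∀ g ∈ H20, (⟪u, schrodinger V g⟫_ℂ).re ≤ (energy V g g).re + M) : u ∈ H1 := by
  let φ : H20Graph →ₗ[ℂ] ℂ :=
    { toFun := fun p => ⟪u, schrodinger V p.1.fst⟫_ℂ
      map_add' := fun p q => by
        rw [← inner_add_right, ← schrodinger_add V (H20_le_H2 p.2.1) (H20_le_H2 q.2.1)]
        rfl
      map_smul' := fun c p => by
        rw [RingHom.id_apply, smul_eq_mul, ← inner_smul_right,
          ← schrodinger_smul V c (H20_le_H2 p.2.1)]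
        rfl }
  have hb (p : H20Graph) : ‖φ p‖ ≤ (1 + ‖mulV V‖ + M) * ‖p‖ := by
    refine norm_le_of_re_le φ (fun p hp => (h _ p.2.1).trans ?_) p
    have hp' : ‖p.1.fst‖ ^ 2 + ‖p.1.snd‖ ^ 2 = 1 := by
      rw [← WithLp.prod_norm_sq_eq_of_L2]
      have : ‖p.1‖ = 1 := hp
      rw [this, one_pow]
    have h1 : (⟪p.1.snd, p.1.snd⟫_ℂ).re = ‖p.1.snd‖ ^ 2 := by
      rw [inner_self_eq_norm_sq_to_K]
      norm_cast
    have h2 : (⟪p.1.fst, mulV V p.1.fst⟫_ℂ).re ≤ ‖mulV V‖ * ‖p.1.fst‖ ^ 2 := by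
      refine (Complex.re_le_norm _).trans ((norm_inner_le_norm _ _).trans ?_)
      have := mul_le_mul_of_nonneg_left ((mulV V).le_opNorm p.1.fst) (norm_nonneg p.1.fst)
      linarith [this, sq ‖p.1.fst‖]
    rw [energy, p.2.2.weakDeriv_eq, Complex.add_re, h1]
    nlinarith [sq_nonneg ‖p.1.fst‖, sq_nonneg ‖p.1.snd‖, norm_nonneg (mulV V)]
  -- The functional is bounded in the `H¹` norm, so Hahn–Banach extends it to `L² ⊕ L²` and the
  -- energy form represents it on `H¹₀` by `w`. Then `u - w` is orthogonal to the range of `S`.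
  obtain ⟨F, hF, -⟩ := exists_extension_norm_eq H20Graph (φ.mkContinuous _ hb)
  obtain ⟨w, hw, h0, H⟩ := exists_energy_eq hε hV le_rfl F
  have hz : ∀ f ∈ H20, ⟪u - w, schrodinger V f⟫_ℂ = 0 := by
    intro f hf
    have h1 := H f (H20_le_H1 hf) (mem_H20_iff.1 hf).2.1
    have h2 := hF ⟨pair f (weakDeriv f), hf, hasWeakDeriv_weakDeriv (H20_le_H1 hf)⟩
    rw [h2, Complex.ofReal_zero, zero_mul, add_zero] at h1
    rw [inner_sub_left, inner_schrodinger_H20 hw hf, h1, sub_eq_zero]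
    rfl
  obtain ⟨c, hc⟩ := eq_smul_eta_of_orthogonal hη hε hV hz
  rw [← sub_add_cancel u w, hc]
  exact H1.add_mem (H1.smul_mem _ (H2_le_H1 hη.1)) hw

theorem forall_re_inner_le_iff {ε : ℝ} (hε : 0 < ε) (hV : ∀ᵐ x ∂vol, ε ≤ V x) {w : L2}
    (hw : w ∈ H1) (h0 : trace w = 0) (M : ℝ) :
    (∀ g ∈ H20, (energy V w g).re ≤ (energy V g g).re + M) ↔ (energy V w w).re / 4 ≤ M := by
  -- Completing the square: the extremal `g` would be `w / 2`. It lies in `H¹₀` but perhaps not in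
  -- `H²₀`, so necessity of the bound is obtained by approximation.
  have key (g : L2) (hg : g ∈ H1) : (energy V (g - (1 / 2 : ℂ) • w) (g - (1 / 2 : ℂ) • w)).re =
      (energy V g g).re - (energy V w g).re + (energy V w w).re / 4 := by
    have hs : (1 / 2 : ℂ) • w ∈ H1 := H1.smul_mem _ hw
    have e : (energy V g w).re = (energy V w g).re := by
      rw [← star_energy, Complex.star_def, Complex.conj_re]
    have h2 : (star (1 / 2) : ℂ) = ((1 / 2 : ℝ) : ℂ) := by simp
    have h3 : (1 / 2 : ℂ) = ((1 / 2 : ℝ) : ℂ) := by simp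
    rw [energy_sub_left V hg hs, energy_sub_right V hg hs, energy_sub_right V hg hs,
      energy_smul_left V _ hw, energy_smul_left V _ hw, energy_smul_right V _ hw,
      energy_smul_right V _ hw, h2, h3]
    simp only [Complex.sub_re, Complex.re_ofReal_mul, e]
    ring
  constructor
  · intro h
    obtain ⟨u, hu, h1, h2⟩ := exists_seq_H20_tendsto (f := (1 / 2 : ℂ) • w) (H1.smul_mem _ hw)
      (by rw [trace_smul _ hw, h0, mul_zero])
    have t1 : Tendsto (fun n => u n - (1 / 2 : ℂ) • w) atTop (𝓝 0) := by
      simpa using h1.sub_const ((1 / 2 : ℂ) • w)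
    have t2 : Tendsto (fun n => weakDeriv (u n - (1 / 2 : ℂ) • w)) atTop (𝓝 0) := by
      simp only [weakDeriv_sub (H20_le_H1 (hu _)) (H1.smul_mem (1 / 2 : ℂ) hw)]
      simpa using h2.sub_const (weakDeriv ((1 / 2 : ℂ) • w))
    have t3 := (t2.inner t2 (𝕜 := ℂ)).add
      (t1.inner (((mulV V).continuous.tendsto 0).comp t1) (𝕜 := ℂ))
    have t4 := (Complex.continuous_re.tendsto _).comp t3
    rw [inner_zero_left, inner_zero_left, add_zero, Complex.zero_re] at t4
    refine le_of_tendsto_of_tendsto (b := atTop) tendsto_const_nhds (t4.add_const M)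
      (Eventually.of_forall fun n => ?_) |>.trans_eq (zero_add M)
    have h3 := key (u n) (H20_le_H1 (hu n))
    have h4 := h (u n) (hu n)
    change _ ≤ (energy V (u n - (1 / 2 : ℂ) • w) (u n - (1 / 2 : ℂ) • w)).re + M
    linarith
  · intro h g hg
    have h1 := key g (H20_le_H1 hg)
    have h2 := re_energy_self_nonneg hε hV (g - (1 / 2 : ℂ) • w)
    linarith

/-- Removing `v(0) η` adds `|v(0)|² η'(0)` to the energy of `v + l`. Green's formula gives `⟨v, S_F
l⟩ = a(v, l) + conj v(0) l'(0)`, and the polarization `q(v + l) - 4 Re a(v, l) = q(v - l)` finishes.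
-/
theorem condition_iff {η v l : L2} (hη : IsEta V η) (hv : v ∈ H1) (hl : l ∈ H2)
    (h0 : trace l = 0) :
    Condition V η v l ↔
      (energy V (v + l - trace v • η) (v + l - trace v • η)).re / 4 ≤
        (⟪v, schrodinger V l⟫_ℂ).re := by
  have hη1 : η ∈ H1 := H2_le_H1 hη.1
  have hl1 : l ∈ H1 := H2_le_H1 hl
  have hu : v + l ∈ H1 := H1.add_mem hv hl1
  have hs : trace v • η ∈ H1 := H1.smul_mem _ hη1
  have e0 : ‖weakDeriv v - weakDeriv l‖ ^ 2 + ∫ x in Ioi (0 : ℝ), ‖v x - l x‖ ^ 2 * V x =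
      (energy V (v - l) (v - l)).re := by
    rw [energy_self_eq, Complex.ofReal_re, weakDeriv_sub hv hl1]
    congr 1
    refine integral_congr_ae ?_
    filter_upwards [Lp.coeFn_sub v l] with x hx
    rw [hx, Pi.sub_apply]
  have hsym : (energy V l v).re = (energy V v l).re := by
    rw [← star_energy, Complex.star_def, Complex.conj_re]
  have e1 : (energy V (v - l) (v - l)).re =
      (energy V v v).re - 2 * (energy V v l).re + (energy V l l).re := by
    rw [energy_sub_left V hv hl1, energy_sub_right V hv hl1, energy_sub_right V hv hl1]
    simp only [Complex.sub_re, hsym]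
    ring
  set d : ℝ := (trace (weakDeriv η)).re with hd
  have hut : trace (v + l) = trace v := by rw [trace_add hv hl1, h0, add_zero]
  have e2 : energy V η (v + l) = -(trace v * d) := by
    rw [energy_eta_left hη hu, star_trace_weakDeriv_eta hη, hut]
  have e3 : energy V (v + l) η = -(star (trace v) * d) := by
    rw [← star_energy, e2, star_neg, star_mul', Complex.star_def,
      Complex.conj_ofReal]
  have e4 : energy V η η = -(d : ℂ) := by
    rw [energy_eta_left hη hη1, star_trace_weakDeriv_eta hη, (isEta_iff.1 hη).2.2, one_mul]
  have e5 : energy V (v + l - trace v • η) (v + l - trace v • η) =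
      energy V (v + l) (v + l) + ((‖trace v‖ ^ 2 * d : ℝ) : ℂ) := by
    have hn : star (trace v) * trace v = ((‖trace v‖ ^ 2 : ℝ) : ℂ) := by
      rw [Complex.star_def, Complex.conj_mul', Complex.ofReal_pow]
    rw [energy_sub_left V hu hs, energy_sub_right V hu hs, energy_sub_right V hu hs,
      energy_smul_left V _ hη1, energy_smul_left V _ hη1, energy_smul_right V _ hη1,
      energy_smul_right V _ hη1, e2, e3, e4, Complex.ofReal_mul, ← hn]
    ring
  have e6 : (energy V (v + l) (v + l)).re =
      (energy V v v).re + 2 * (energy V v l).re + (energy V l l).re := by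
    rw [energy_add_left V hv hl1, energy_add_right V hv hl1, energy_add_right V hv hl1]
    simp only [Complex.add_re, hsym]
    ring
  rw [Condition, e0, e1, ← hd, e5, Complex.add_re, Complex.ofReal_re, e6,
    inner_schrodinger hv hl, Complex.add_re]
  constructor <;> intro h <;> linarith

theorem isDissipative_Aop_iff_condition {ε : ℝ} (hε : 0 < ε) (hV : ∀ᵐ x ∂vol, ε ≤ V x)
    {η v l : L2} (hη : IsEta V η) (hv : v ∉ H20) (hl : l ∈ H2) (h0 : trace l = 0) :
    IsDissipative (Aop V v l hv) ↔ v ∈ H1 ∧ Condition V η v l := by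
  have hl1 : l ∈ H1 := H2_le_H1 hl
  have hη1 : η ∈ H1 := H2_le_H1 hη.1
  have key (hv1 : v ∈ H1) : IsDissipative (Aop V v l hv) ↔ Condition V η v l := by
    have hu : v + l ∈ H1 := H1.add_mem hv1 hl1
    have hs : trace v • η ∈ H1 := H1.smul_mem _ hη1
    have hw0 : trace (v + l - trace v • η) = 0 := by
      rw [trace_sub hu hs, trace_add hv1 hl1, h0, trace_smul _ hη1, (isEta_iff.1 hη).2.2]
      ring
    rw [isDissipative_Aop_iff hε hV hv hl, condition_iff hη hv1 hl h0,
      ← forall_re_inner_le_iff hε hV (H1.sub_mem hu hs) hw0]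
    refine forall₂_congr fun g hg => ?_
    rw [inner_schrodinger_H20 hu hg, energy_sub_left V hu hs, energy_smul_left V _ hη1,
      energy_eta_left hη (H20_le_H1 hg), (mem_H20_iff.1 hg).2.1, zero_mul, neg_zero, mul_zero,
      sub_zero]
  refine ⟨fun h => ?_, fun h => (key h.1).2 h.2⟩
  have hv1 : v ∈ H1 := by
    have := mem_H1_of_forall_le hε hV hη ((isDissipative_Aop_iff hε hV hv hl).1 h)
    rw [← add_sub_cancel_right v l]
    exact H1.sub_mem this hl1
  exact ⟨hv1, (key hv1).1 h⟩

/-! ## Maximality -/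

theorem exists_resolvent_eq {ε : ℝ} (hε : 0 < ε) (hV : ∀ᵐ x ∂vol, ε ≤ V x) {v l : L2}
    {hv : v ∉ H20} (h : IsDissipative (Aop V v l hv)) (y : L2) :
    ∃ x : (Aop V v l hv).domain, Aop V v l hv x + Complex.I • (x : L2) = Complex.I • y := by
  obtain ⟨a, ha, ha0, hav⟩ :=
    exists_schrodinger_add_smul_eq hε hV zero_le_one (schrodinger V l + v)
  obtain ⟨b, hb, hb0, hbv⟩ := exists_schrodinger_add_smul_eq hε hV zero_le_one y
  rw [Complex.ofReal_one, one_smul] at hav hbv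
  -- If `a'(0) = 0`, then `a ∈ H²₀` and `v - a` is an eigenvector of `-i A_{v,ℓ}` with eigenvalue
  -- `-1`, unless it is zero. Dissipativity forces `v = a`, contrary to `v ∉ H²₀`.
  have hne : trace (weakDeriv a) ≠ 0 := by
    intro h0
    have ha20 : a ∈ H20 := mem_H20_iff.2 ⟨ha, ha0, h0⟩
    have hm : v - a = -a + (1 : ℂ) • v := by rw [one_smul]; abel
    have h1 := h.2 ⟨v - a, mem_Aop_domain.2 ⟨-a, H20.neg_mem ha20, 1, hm⟩⟩
    have e : schrodinger V l - schrodinger V a = -(v - a) := by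
      have : schrodinger V a = schrodinger V l + v - a := eq_sub_of_add_eq hav
      rw [this]; abel
    rw [Aop_apply (H20.neg_mem ha20) 1 _ hm, im_inner_I_smul, one_smul,
      schrodinger_neg ha, neg_add_eq_sub, e, inner_neg_right, Complex.neg_re,
      inner_self_eq_norm_sq_to_K] at h1
    have h2 : ‖v - a‖ ^ 2 ≤ 0 := by
      have : (((‖v - a‖ : ℝ) : ℂ) ^ 2).re = ‖v - a‖ ^ 2 := by norm_cast
      have h3 : 0 ≤ -(((‖v - a‖ : ℝ) : ℂ) ^ 2).re := h1
      linarith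
    have h3 : v = a :=
      sub_eq_zero.1 (norm_eq_zero.1 (pow_eq_zero_iff two_ne_zero |>.1
        (le_antisymm h2 (sq_nonneg _))))
    exact hv (h3 ▸ ha20)
  -- With this choice `b - μ a` has vanishing derivative at `0`; the terms `μ (S_F l + v)` cancel in
  -- the equation for `b - μ a + μ v`.
  set μ : ℂ := trace (weakDeriv b) / trace (weakDeriv a) with hμ
  have hsa : μ • a ∈ H2 := H2.smul_mem _ ha
  have hg : b - μ • a ∈ H20 := by
    refine mem_H20_iff.2 ⟨H2.sub_mem hb hsa, ?_, ?_⟩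
    · rw [trace_sub (H2_le_H1 hb) (H2_le_H1 hsa), trace_smul _ (H2_le_H1 ha), ha0, hb0, mul_zero,
        sub_zero]
    · rw [weakDeriv_sub (H2_le_H1 hb) (H2_le_H1 hsa), weakDeriv_smul _ (H2_le_H1 ha),
        trace_sub (weakDeriv_mem_H1 hb) (H1.smul_mem _ (weakDeriv_mem_H1 ha)),
        trace_smul _ (weakDeriv_mem_H1 ha), hμ, div_mul_cancel₀ _ hne, sub_self]
  refine ⟨⟨b - μ • a + μ • v, mem_Aop_domain.2 ⟨_, hg, μ, rfl⟩⟩, ?_⟩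
  rw [Aop_apply hg μ _ rfl, ← smul_add, schrodinger_sub hb hsa, schrodinger_smul V _ ha]
  congr 1
  have h1 : schrodinger V b = y - b := eq_sub_of_add_eq hbv
  have h2 : schrodinger V a = schrodinger V l + v - a := eq_sub_of_add_eq hav
  rw [h1, h2]
  module

theorem isMaximallyDissipative_Aop {ε : ℝ} (hε : 0 < ε) (hV : ∀ᵐ x ∂vol, ε ≤ V x) {v l : L2}
    {hv : v ∉ H20} (h : IsDissipative (Aop V v l hv)) :
    IsMaximallyDissipative (Aop V v l hv) := by
  refine ⟨h, fun B hB hAB => (LinearPMap.eq_of_le_of_domain_eq hAB (le_antisymm hAB.1 ?_)).symm⟩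
  intro x hx
  -- The right-hand side is chosen so that `(A + i) z = (B + i) x`. Then `B (z - x) = -i (z - x)`,
  -- and dissipativity of `B` forces `z = x`.
  obtain ⟨z, hz⟩ := exists_resolvent_eq hε hV h (-Complex.I • B ⟨x, hx⟩ + x)
  have hzB : (z : L2) ∈ B.domain := hAB.1 z.2
  have e1 : Aop V v l hv z = B ⟨z, hzB⟩ := hAB.2 rfl
  rw [e1, smul_add, smul_smul, mul_neg, Complex.I_mul_I, neg_neg, one_smul] at hz
  have e2 : B (⟨z, hzB⟩ - ⟨x, hx⟩) = -(Complex.I • ((z : L2) - x)) := by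
    have : B ⟨z, hzB⟩ = B ⟨x, hx⟩ + Complex.I • x - Complex.I • (z : L2) := eq_sub_of_add_eq hz
    rw [LinearPMap.map_sub, this, smul_sub]
    abel
  have h1 := hB.2 (⟨z, hzB⟩ - ⟨x, hx⟩)
  rw [e2, inner_neg_right, Complex.neg_im, im_inner_I_smul] at h1
  have h2 : (⟪(z : L2) - x, (z : L2) - x⟫_ℂ).re ≤ 0 := neg_nonneg.1 h1
  have h3 : (z : L2) - x = 0 := by
    rw [inner_self_eq_norm_sq_to_K] at h2
    have h4 : ‖(z : L2) - x‖ ^ 2 ≤ 0 := by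
      refine le_of_eq_of_le ?_ h2
      norm_cast
    exact norm_eq_zero.1 (pow_eq_zero_iff two_ne_zero |>.1 (le_antisymm h4 (sq_nonneg _)))
  rw [← sub_eq_zero.1 h3]
  exact z.2

theorem isMaximallyDissipative_Aop_iff {ε : ℝ} (hε : 0 < ε) (hV : ∀ᵐ x ∂vol, ε ≤ V x)
    {η v l : L2} (hη : IsEta V η) (hv : v ∉ H20) (hl : l ∈ H2) (h0 : trace l = 0) :
    IsMaximallyDissipative (Aop V v l hv) ↔ v ∈ H1 ∧ Condition V η v l :=
  ⟨fun h => (isDissipative_Aop_iff_condition hε hV hη hv hl h0).1 h.1,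
    fun h => isMaximallyDissipative_Aop hε hV
      ((isDissipative_Aop_iff_condition hε hV hη hv hl h0).2 h)⟩

/-! ### Accretive operators and extensions of `S`. -/

theorem I_smul_neg_I_smul (A : L2 →ₗ.[ℂ] L2) : Complex.I • -Complex.I • A = A := by
  rw [smul_smul, mul_neg, Complex.I_mul_I, neg_neg, one_smul]

theorem neg_I_smul_I_smul (A : L2 →ₗ.[ℂ] L2) : -Complex.I • Complex.I • A = A := by
  rw [smul_smul, neg_mul, Complex.I_mul_I, neg_neg, one_smul]

theorem isMaximallyAccretive_neg_I_smul_iff (A : L2 →ₗ.[ℂ] L2) :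
    IsMaximallyAccretive (-Complex.I • A) ↔ IsMaximallyDissipative A := by
  rw [IsMaximallyAccretive, I_smul_neg_I_smul]

theorem S_le_neg_I_smul_Aop {v l : L2} (hv : v ∉ H20) :
    S V ≤ -Complex.I • Aop V v l hv := by
  refine ⟨fun f hf => (mem_Aop_domain (hv := hv)).2 ⟨f, hf, 0, by simp⟩, fun f g hfg => ?_⟩
  rw [LinearPMap.smul_apply]
  have h : Aop V v l hv g = Complex.I • (schrodinger V f + (0 : ℂ) • schrodinger V l) :=
    Aop_apply f.2 0 g (by rw [zero_smul, add_zero, hfg])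
  rw [h, smul_smul, neg_mul, Complex.I_mul_I, neg_neg, one_smul, zero_smul, add_zero]
  rfl

theorem Aop_le {v l : L2} (hv : v ∉ H20) {B : L2 →ₗ.[ℂ] L2} (hB : Complex.I • S V ≤ B)
    (x : B.domain) (hx : (x : L2) = v) (hxl : B x = Complex.I • schrodinger V l) :
    Aop V v l hv ≤ B := by
  subst hx
  refine ⟨fun z hz => ?_, fun z w hzw => ?_⟩
  · obtain ⟨f, hf, c, rfl⟩ := mem_Aop_domain.1 hz
    exact B.domain.add_mem (hB.1 hf) (B.domain.smul_mem c x.2)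
  · obtain ⟨f, hf, c, hz⟩ := mem_Aop_domain.1 z.2
    have e : w = ⟨f, hB.1 hf⟩ + c • x := Subtype.ext (hzw.symm.trans hz)
    have e1 : B ⟨f, hB.1 hf⟩ = Complex.I • schrodinger V f :=
      (hB.2 (x := ⟨f, hf⟩) (y := ⟨f, hB.1 hf⟩) rfl).symm
    rw [Aop_apply hf c z hz, e, LinearPMap.map_add, LinearPMap.map_smul, hxl, e1, smul_add,
      smul_comm Complex.I c]

/-- A maximally dissipative extension of `i S` has a domain larger than `H²₀(ℝ⁺)`. -/
theorem exists_mem_domain_notMem_H20 {ε : ℝ} (hε : 0 < ε) (hV : ∀ᵐ x ∂vol, ε ≤ V x)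
    {η : L2} (hη : IsEta V η) {B : L2 →ₗ.[ℂ] L2} (hB : IsMaximallyDissipative B)
    (hS : Complex.I • S V ≤ B) : ∃ x : B.domain, (x : L2) ∉ H20 := by
  by_contra! hall
  have hBS : Complex.I • S V = B :=
    LinearPMap.eq_of_le_of_domain_eq hS (le_antisymm hS.1 fun x hx => hall ⟨x, hx⟩)
  -- With `S_F u = η`, `u'(0) = ⟨η, η⟩ ≠ 0`, so `u ∉ H²₀`. The operator `A_{u,u}` is a restriction
  -- of `i S_F`, hence a proper dissipative extension of `i S`, so `i S` is not maximal.
  obtain ⟨u, hu, h0, h⟩ := exists_schrodinger_add_smul_eq hε hV le_rfl η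
  rw [Complex.ofReal_zero, zero_smul, add_zero] at h
  have hne : trace (weakDeriv u) ≠ 0 := by
    rw [← inner_eta_schrodinger hη hu h0, h]
    exact inner_self_ne_zero.2 (eta_ne_zero hη)
  have hu20 : u ∉ H20 := fun hm => hne (mem_H20_iff.1 hm).2.2
  have hdiss : IsDissipative (Aop V u u hu20) := by
    refine ⟨dense_Aop_domain, fun x => ?_⟩
    obtain ⟨f, hf, c, hx⟩ := mem_Aop_domain.1 x.2
    have hcu : c • u ∈ H2 := H2.smul_mem _ hu
    have ht : trace (f + c • u) = 0 := by
      rw [trace_add (H20_le_H1 hf) (H2_le_H1 hcu), trace_smul _ (H2_le_H1 hu), h0,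
        (mem_H20_iff.1 hf).2.1, mul_zero, add_zero]
    have hm : f + c • u ∈ H2 := H2.add_mem (H20_le_H2 hf) hcu
    rw [Aop_apply hf c x hx, im_inner_I_smul, hx, ← schrodinger_smul V _ hu,
      ← schrodinger_add V (H20_le_H2 hf) hcu, inner_schrodinger (H2_le_H1 hm) hm, ht, star_zero,
      zero_mul, add_zero]
    exact re_energy_self_nonneg hε hV _
  have hle : B ≤ Aop V u u hu20 := by
    rw [← hBS]
    refine ⟨fun f hf => mem_Aop_domain.2 ⟨f, hf, 0, by simp⟩, fun f g hfg => ?_⟩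
    have h : Aop V u u hu20 g = Complex.I • (schrodinger V f + (0 : ℂ) • schrodinger V u) :=
      Aop_apply f.2 0 g (by rw [zero_smul, add_zero, hfg])
    rw [h, zero_smul, add_zero, LinearPMap.smul_apply]
    rfl
  have heq := hB.2 _ hdiss hle
  have hmem : u ∈ (Aop V u u hu20).domain :=
    mem_Aop_domain.2 ⟨0, H20.zero_mem, 1, by simp⟩
  rw [heq] at hmem
  exact hu20 (hall ⟨u, hmem⟩)

end HalfLine

theorem mainTheorem5 (V : HalfLine.LInf) (ε : ℝ) (hε : 0 < ε)
    (hV : ∀ᵐ x ∂(volume.restrict (Ioi (0 : ℝ))), ε ≤ V x) :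
    -- the Friedrichs extension of `S` acts as `-ℓ'' + V ℓ` on `{ℓ ∈ H² : ℓ(0) = 0}`
    (∀ l w : HalfLine.L2, FriedrichsGraph (HalfLine.S V) l w ↔
      l ∈ HalfLine.H2 ∧ HalfLine.HasTrace l 0 ∧ w = HalfLine.schrodinger V l) ∧
    -- the function `η` exists and is unique
    (∃! η : HalfLine.L2, HalfLine.IsEta V η) ∧
    ∀ η : HalfLine.L2, HalfLine.IsEta V η →
      (HalfLine.trace (HalfLine.weakDeriv η)).im = 0 ∧
      -- which of the operators `A_{v,ℓ}` are maximally dissipative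
      (∀ (v l : HalfLine.L2) (hv : v ∉ HalfLine.H20),
        l ∈ HalfLine.H2 → HalfLine.HasTrace l 0 →
        (IsMaximallyDissipative (HalfLine.Aop V v l hv) ↔
          v ∈ HalfLine.H1 ∧ HalfLine.Condition V η v l) ∧
        (IsMaximallyAccretive (-Complex.I • HalfLine.Aop V v l hv) ↔
          v ∈ HalfLine.H1 ∧ HalfLine.Condition V η v l)) ∧
      -- the maximally accretive extensions of `S` are exactly the operators `-i A_{v,ℓ}`
      (∀ T : HalfLine.L2 →ₗ.[ℂ] HalfLine.L2,
        (HalfLine.S V ≤ T ∧ IsMaximallyAccretive T) ↔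
          ∃ (v l : HalfLine.L2) (hv : v ∉ HalfLine.H20),
            v ∈ HalfLine.H1 ∧ l ∈ HalfLine.H2 ∧ HalfLine.HasTrace l 0 ∧
            HalfLine.Condition V η v l ∧ T = -Complex.I • HalfLine.Aop V v l hv) := by
  refine ⟨HalfLine.friedrichsGraph_S_iff hε hV, HalfLine.existsUnique_isEta hε hV, fun η hη =>
    ⟨HalfLine.trace_weakDeriv_eta_im hη, fun v l hv hl h0 => ?_, fun T => ⟨?_, ?_⟩⟩⟩
  · rw [HalfLine.isMaximallyAccretive_neg_I_smul_iff]
    exact ⟨HalfLine.isMaximallyDissipative_Aop_iff hε hV hη hv hl h0.trace_eq,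
      HalfLine.isMaximallyDissipative_Aop_iff hε hV hη hv hl h0.trace_eq⟩
  · rintro ⟨hST, hT⟩
    have hle : Complex.I • HalfLine.S V ≤ Complex.I • T :=
      ⟨hST.1, fun x y hxy => by
        rw [LinearPMap.smul_apply, LinearPMap.smul_apply, hST.2 (x := x) (y := y) hxy]⟩
    obtain ⟨x, hx⟩ := HalfLine.exists_mem_domain_notMem_H20 hε hV hη hT hle
    -- Since `S_F` is onto, any value `T x` has the form `S_F l`; this is why the parametrization by
    -- `l` misses nothing.
    obtain ⟨l, hl, h0, h⟩ := HalfLine.exists_schrodinger_add_smul_eq hε hV le_rfl (T x)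
    rw [Complex.ofReal_zero, zero_smul, add_zero] at h
    have hA : HalfLine.Aop V x l hx ≤ Complex.I • T :=
      HalfLine.Aop_le hx hle x rfl (by rw [LinearPMap.smul_apply, h])
    have hdiss : IsDissipative (HalfLine.Aop V x l hx) := by
      refine ⟨HalfLine.dense_Aop_domain, fun z => ?_⟩
      rw [hA.2 (x := z) (y := ⟨z, hA.1 z.2⟩) rfl]
      exact hT.1.2 ⟨z, hA.1 z.2⟩
    -- One extra dimension already suffices: `A_{x,l}` inherits dissipativity from `i T`, is
    -- therefore maximal, and must equal it.
    have heq := (HalfLine.isMaximallyDissipative_Aop hε hV hdiss).2 _ hT.1 hA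
    obtain ⟨hv1, hc⟩ :=
      (HalfLine.isDissipative_Aop_iff_condition hε hV hη hx hl h0).1 hdiss
    refine ⟨x, l, hx, hv1, hl, h0 ▸ HalfLine.hasTrace_trace (HalfLine.H2_le_H1 hl), hc, ?_⟩
    rw [← heq, HalfLine.neg_I_smul_I_smul]
  · rintro ⟨v, l, hv, hv1, hl, h0, hc, rfl⟩
    exact ⟨HalfLine.S_le_neg_I_smul_Aop hv,
      (HalfLine.isMaximallyAccretive_neg_I_smul_iff _).2
        ((HalfLine.isMaximallyDissipative_Aop_iff hε hV hη hv hl h0.trace_eq).2 ⟨hv1, hc⟩)⟩
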